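/- Let $d\ge 1$, let $K\colon\mathbb R^d\times\mathbb R^d\to\mathbb C$ be continuous, bounded and positive semidefinite, and let $\alpha\ge -1$. Let $\eta$ be a stationary (simple, locally finite) point process on $\mathbb R^d$ which is $\alpha$-determinantal with kernel $K$, that is, for each $n\ge 1$ the $n$-th factorial moment measure $$\alpha_n(\cdot)=\mathbb E\sum_{x_1,\dots,x_n\in\eta}^{\ne}\mathbf 1\{(x_1,\dots,x_n)\in\cdot\}$$ (summation over $n$-tuples of pairwise distinct points) has the Lebesgue density $$\rho_n(x_1,\dots,x_n)=\sum_{\pi}\alpha^{\,n-\#\pi}\prod_{j=1}^nK(x_j,x_{\pi(j)}),$$ where the sum is over all permutations $\pi$ of $\{1,\dots,n\}$ and $\#\pi$ is the number of cycles of $\pi$ (with $0^0=1$). Suppose that $$\int_{\mathbb R^d}\|x\|\,|K(0,x)|\,dx<\infty .$$ Then $\mathbb E\,\eta(B)^m<\infty$ for each bounded Borel set $B$ and each $m\in\mathbb N$, and for each $m\ge 2$ $$\int(1+\|x_1\|)\,|\beta^!_m|(d(x_1,\dots,x_{m-1}))<\infty .$$ Here the $m$-th factorial cumulant measure $\beta_m$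 is the locally finite signed measure on $(\mathbb R^d)^m$ with $$\beta_m(B_1\times\cdots\times B_m)=\sum_{\pi}(-1)^{|\pi|-1}(|\pi|-1)!\prod_{I\in\pi}\alpha_{|I|}\big(\textstyle\prod_{i\in I}B_i\big)$$ for bounded Borel sets $B_1,\dots,B_m$, the sum being over all partitions $\pi$ of $\{1,\dots,m\}$; the $m$-th reduced factorial cumulant measure $\beta^!_m$ is the locally finite signed measure on $(\mathbb R^d)^{m-1}$ with $$\beta_m(C)=\iint\mathbf 1\{(x,x_1+x,\dots,x_{m-1}+x)\in C\}\,\beta^!_m(d(x_1,\dots,x_{m-1}))\,dx$$ for bounded Borel sets $C$; and $|\beta^!_m|$ is its total variation measure. (The existence of these signed measures is part of the assertion.) -/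

import Mathlib

open MeasureTheory ProbabilityTheory
open scoped ENNReal NNReal ComplexOrder

/-- `E d` is `ℝ^d` with the Euclidean norm. -/
abbrev E (d : ℕ) : Type := EuclideanSpace ℝ (Fin d)

/-- The space of locally finite subsets of `ℝ^d`. -/
structure LocFinSet (d : ℕ) where
  carrier : Set (E d)
  finite_inter : ∀ B : Set (E d), Bornology.IsBounded B → (carrier ∩ B).Finite

namespace LocFinSet

variable {d : ℕ}

/-- `μ.count B` is the number `μ(B)` of points of `μ` in `B`. -/
noncomputable def count (μ : LocFinSet d) (B : Set (E d)) : ℕ∞ := (μ.carrier ∩ B).encard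

/-- The smallest σ-field making `μ ↦ μ(B)` measurable for all Borel sets `B`. -/
noncomputable instance : MeasurableSpace (LocFinSet d) :=
  ⨆ B : {B : Set (E d) // MeasurableSet B},
    MeasurableSpace.comap (fun μ : LocFinSet d => μ.count B.1) inferInstance

/-- The translate `μ + x = {y + x : y ∈ μ}`. -/
def shift (μ : LocFinSet d) (x : E d) : LocFinSet d where
  carrier := (fun y => y + x) '' μ.carrier
  finite_inter := by
    intro B hB
    have hB' : Bornology.IsBounded ((fun y => y - x) '' B) := by
      obtain ⟨C, hC⟩ := hB.exists_norm_le
      refine (isBounded_iff_forall_norm_le).2 ⟨C + ‖x‖, ?_⟩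
      rintro _ ⟨y, hy, rfl⟩
      exact (norm_sub_le y x).trans (by gcongr; exact hC y hy)
    refine ((μ.finite_inter _ hB').image (fun y => y + x)).subset ?_
    rintro _ ⟨⟨y, hy, rfl⟩, hyB⟩
    exact ⟨y, ⟨hy, ⟨y + x, hyB, by simp⟩⟩, rfl⟩

end LocFinSet

section PointProcess

variable {d : ℕ} {Ω : Type*} [MeasurableSpace Ω]

/-- `η` is a (simple) point process: a random element of the space of locally finite sets. -/
def IsPointProcess (η : Ω → LocFinSet d) : Prop := Measurable η

/-- The distribution of `η + x` does not depend on `x`. -/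
def IsStationaryProcess (P : Measure Ω) (η : Ω → LocFinSet d) : Prop :=
  ∀ x : E d, IdentDistrib (fun ω => (η ω).shift x) η P P

/-- `𝔼 η(B)^m < ∞` for all `m` and all bounded Borel sets `B`. -/
def HasFiniteMoments (P : Measure Ω) (η : Ω → LocFinSet d) : Prop :=
  ∀ (m : ℕ) (B : Set (E d)), MeasurableSet B → Bornology.IsBounded B →
    ∫⁻ ω, (((η ω).count B : ℕ∞) : ℝ≥0∞) ^ m ∂P < ∞

/-- The tuples `(x_i)`, indexed by `ι`, of pairwise distinct points of `μ`. -/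
def distinctTuples (ι : Type*) (μ : LocFinSet d) : Set (ι → E d) :=
  {x | Function.Injective x ∧ ∀ i, x i ∈ μ.carrier}

/-- The value on a Borel set `B` of the factorial moment measure of `η`, for tuples indexed by `ι`:
the expected number of tuples of pairwise distinct points of `η` which belong to `B`. -/
noncomputable def factorialMoment (P : Measure Ω) (η : Ω → LocFinSet d) {ι : Type*}
    (B : Set (ι → E d)) : ℝ≥0∞ :=
  ∫⁻ ω, ((distinctTuples ι (η ω) ∩ B).encard : ℝ≥0∞) ∂P

/-- `ρ` is the `n`-th correlation function of `η`: a density of the `n`-th factorial moment measure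
with respect to Lebesgue measure. -/
def IsCorrelationFunction (P : Measure Ω) (η : Ω → LocFinSet d) (n : ℕ)
    (ρ : (Fin n → E d) → ℝ≥0) : Prop :=
  Measurable ρ ∧ ∀ B : Set (Fin n → E d), MeasurableSet B →
    factorialMoment P η B = ∫⁻ x in B, (ρ x : ℝ≥0∞)

/-- `∑_π α^(n - #π) ∏_j K(x_j, x_π(j))`, the sum being over all permutations `π` of `n` elements;
`#π` is the number of cycles of `π`, fixed points included. -/
noncomputable def alphaDet (α : ℝ) (K : E d → E d → ℂ) (n : ℕ) (x : Fin n → E d) : ℂ :=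
  ∑ π : Equiv.Perm (Fin n), (α : ℂ) ^ (n - π.partition.parts.card) * ∏ j, K (x j) (x (π j))

/-- `η` is `α`-determinantal with kernel `K`. -/
def IsAlphaDeterminantal (P : Measure Ω) (η : Ω → LocFinSet d) (α : ℝ) (K : E d → E d → ℂ) :
    Prop :=
  ∀ n : ℕ, 1 ≤ n → ∃ ρ : (Fin n → E d) → ℝ≥0,
    IsCorrelationFunction P η n ρ ∧ ∀ x, ((ρ x : ℝ) : ℂ) = alphaDet α K n x

/-- The value of the `m`-th factorial cumulant measure on `B_1 × ⋯ × B_m`: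
`∑_π (-1)^(|π|-1) (|π|-1)! ∏_{I ∈ π} α_{|I|}(×_{i ∈ I} B_i)`, the sum being over all partitions
`π` of the index set. -/
noncomputable def factorialCumulant (P : Measure Ω) (η : Ω → LocFinSet d) (m : ℕ)
    (B : Fin m → Set (E d)) : ℝ :=
  ∑ π : Finpartition (Finset.univ : Finset (Fin m)),
    (-1 : ℝ) ^ (π.parts.card - 1) * ((π.parts.card - 1).factorial : ℝ) *
      ∏ I ∈ π.parts, (factorialMoment P η (Set.univ.pi fun i : I => B i.1)).toReal

end PointProcess

/-- A locally finite signed measure, given by its Jordan decomposition: two mutually singular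
measures that are finite on bounded sets. -/
structure LocFinSignedMeasure (X : Type*) [MeasurableSpace X] [Bornology X] where
  pos : Measure X
  neg : Measure X
  pos_lt_top : ∀ B : Set X, Bornology.IsBounded B → pos B < ∞
  neg_lt_top : ∀ B : Set X, Bornology.IsBounded B → neg B < ∞
  mutuallySingular : pos ⟂ₘ neg

namespace LocFinSignedMeasure

variable {X : Type*} [MeasurableSpace X] [Bornology X]

/-- The value of a locally finite signed measure on a bounded measurable set. -/
noncomputable def value (β : LocFinSignedMeasure X) (B : Set X) : ℝ := β.pos.real B - β.neg.real B

/-- The total variation measure. -/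
noncomputable def totalVariation (β : LocFinSignedMeasure X) : Measure X := β.pos + β.neg

end LocFinSignedMeasure

section Cumulant

variable {d : ℕ} {Ω : Type*} [MeasurableSpace Ω]

/-- `β` is the `m`-th factorial cumulant measure of `η`. -/
def IsFactorialCumulantMeasure (P : Measure Ω) (η : Ω → LocFinSet d) (m : ℕ)
    (β : LocFinSignedMeasure (Fin m → E d)) : Prop :=
  ∀ B : Fin m → Set (E d), (∀ i, MeasurableSet (B i)) → (∀ i, Bornology.IsBounded (B i)) →
    β.value (Set.univ.pi B) = factorialCumulant P η m B

/-- `β'` is the reduced measure of the shift invariant signed measure `β` on `(ℝ^d)^(n+1)`: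
`β(C) = ∫∫ 1{(x, y_1 + x, …, y_n + x) ∈ C} β'(d(y_1, …, y_n)) dx` for bounded Borel sets `C`. -/
def IsReducedMeasure {n : ℕ} (β : LocFinSignedMeasure (Fin (n + 1) → E d))
    (β' : LocFinSignedMeasure (Fin n → E d)) : Prop :=
  ∀ C : Set (Fin (n + 1) → E d), MeasurableSet C → Bornology.IsBounded C →
    β.value C =
      ∫ x : E d, β'.value {y | (Fin.cons x (fun i => y i + x) : Fin (n + 1) → E d) ∈ C}

/-- The cumulant condition: for each `m = k + 2 ≥ 2` the `m`-th reduced factorial cumulant measure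
`β'` of `η` satisfies `∫ (1 + ‖y_1‖) |β'|(d(y_1, …, y_{m-1})) < ∞`. The signed measures `β` and `β'`
are uniquely determined by the two properties demanded of them. -/
def CumulantCondition (P : Measure Ω) (η : Ω → LocFinSet d) : Prop :=
  ∀ k : ℕ, ∃ (β : LocFinSignedMeasure (Fin (k + 2) → E d))
    (β' : LocFinSignedMeasure (Fin (k + 1) → E d)),
    IsFactorialCumulantMeasure P η (k + 2) β ∧ IsReducedMeasure β β' ∧
      ∫⁻ y, ENNReal.ofReal (1 + ‖y 0‖) ∂β'.totalVariation < ∞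

end Cumulant

/-! ### Cycle counts of permutations and the moment-to-cumulant formula -/

section Combinatorics

open Equiv

variable {V W : Type*} [Fintype V] [DecidableEq V] [Fintype W] [DecidableEq W]

/-! The factorial cumulant measure has the density `cumulantDensity`, the same alternating sum over
partitions applied to the correlation functions. By the exponential formula
(`sum_finpartition_permSum`) it equals `α ^ (m - 1)` times the sum of `∏ j, K (x j) (x (σ j))` over
the permutations `σ` that form a single cycle. To see this, colour the points with `t` colours and
sum the product of the `α`-determinants of the colour classes. Sorting by permutations gives a
polynomial in `t` whose powers count cycles; sorting by partitions gives descending factorials of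
`t`. Compare the coefficients of `t`.

Stationarity and continuity make the correlation functions translation invariant
(`correlation_translate`), so the reduced cumulant measure has density `y ↦ cumulantDensity (0, y)`.
The kernel need not be invariant, but for `α ≠ 0` the first two correlation functions force `‖K (x +
z) (y + z)‖ = ‖K x y‖` (`norm_kernel_translate`). For `α = 0` the cumulants of order at least two
vanish.

In a cyclic product started at `0`, bound the closing factor by a constant. The others are `‖K 0 z‖`
at the increments `z` of a path, and the weight `1 + ‖y 0‖` is at most the product of `1 + ‖z‖` over
these increments. The integral is thus bounded by a constant times a power of `∫ (1 + ‖z‖) ‖K 0 z‖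
dz`, which is finite. Finite moments follow from the boundedness of the correlation functions. -/

theorem card_parts_partition_eq_card_quotient (σ : Perm V) [Fintype (Quotient (Perm.SameCycle.setoid σ))] :
    σ.partition.parts.card = Fintype.card (Quotient (Perm.SameCycle.setoid σ)) := by
  classical
  have h1 : σ.partition.parts.card
      = Fintype.card (σ.cycleFactorsFinset ⊕ {v : V // v ∉ σ.support}) := by
    rw [Perm.parts_partition, Multiset.card_add, Multiset.card_replicate, Perm.cycleType_def,
      Fintype.card_sum]
    have h := Finset.card_filter_add_card_filter_not (s := (Finset.univ : Finset V)) (fun x => σ x = x)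
    rw [Finset.card_univ] at h
    simp [Fintype.card_subtype, Perm.support]
    omega
  rw [h1]
  have hmem : ∀ v, v ∈ σ.support → σ.cycleOf v ∈ σ.cycleFactorsFinset := fun v hv =>
    Perm.cycleOf_mem_cycleFactorsFinset_iff.2 hv
  -- `F` names the orbit of a point: the cycle through it, or the point itself if it is fixed.
  let F : V → σ.cycleFactorsFinset ⊕ {v : V // v ∉ σ.support} := fun v =>
    if hv : v ∈ σ.support then Sum.inl ⟨σ.cycleOf v, hmem v hv⟩ else Sum.inr ⟨v, hv⟩
  have hF : ∀ v w, F v = F w ↔ σ.SameCycle v w := by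
    intro v w
    by_cases hv : v ∈ σ.support <;> by_cases hw : w ∈ σ.support
    · simp only [F, hv, hw, dif_pos, Sum.inl.injEq, Subtype.mk.injEq]
      constructor
      · intro h
        have : w ∈ (σ.cycleOf v).support := by
          rw [h, Perm.mem_support_cycleOf_iff]
          exact ⟨Perm.SameCycle.refl _ _, hw⟩
        exact (Perm.mem_support_cycleOf_iff.1 this).1
      · exact fun h => h.cycleOf_eq
    · simp only [F, hv, hw, dif_pos, not_false_eq_true, dif_neg, reduceCtorEq, false_iff]
      intro h
      exact hw (by
        have := (Perm.SameCycle.apply_eq_self_iff h)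
        rw [Perm.mem_support] at *
        tauto)
    · simp only [F, hv, hw, dif_pos, not_false_eq_true, dif_neg, reduceCtorEq, false_iff]
      intro h
      exact hv (by
        have := (Perm.SameCycle.apply_eq_self_iff h)
        rw [Perm.mem_support] at *
        tauto)
    · simp only [F, hv, hw, not_false_eq_true, dif_neg, Sum.inr.injEq, Subtype.mk.injEq]
      constructor
      · rintro rfl; exact Perm.SameCycle.refl _ _
      · intro h
        exact h.eq_of_left (by simpa [Function.IsFixedPt] using hv)
  symm
  refine Fintype.card_of_bijective (f := Quotient.lift F fun a b h => (hF a b).2 h) ⟨?_, ?_⟩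
  · rintro ⟨v⟩ ⟨w⟩ h
    exact Quotient.sound ((hF v w).1 h)
  · rintro (⟨c, hc⟩ | ⟨v, hv⟩)
    · obtain ⟨v, hv⟩ := (Perm.mem_cycleFactorsFinset_iff.1 hc).1.nonempty_support
      refine ⟨Quotient.mk _ v, ?_⟩
      have hvs : v ∈ σ.support := Perm.mem_cycleFactorsFinset_support_le hc hv
      have : σ.cycleOf v = c := (Perm.cycle_is_cycleOf hv hc).symm
      simp only [Quotient.lift_mk, F, hvs, dif_pos, this]
    · exact ⟨Quotient.mk _ v, by simp only [Quotient.lift_mk, F, hv, not_false_eq_true, dif_neg]⟩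

theorem card_parts_partition_le (σ : Perm V) : σ.partition.parts.card ≤ Fintype.card V := by
  classical
  rw [card_parts_partition_eq_card_quotient]
  exact Fintype.card_quotient_le _

theorem card_parts_partition_congr (e : V ≃ W) (σ : Perm V) :
    (e.permCongr σ).partition.parts.card = σ.partition.parts.card := by
  classical
  rw [card_parts_partition_eq_card_quotient, card_parts_partition_eq_card_quotient]
  refine (Fintype.card_congr (Quotient.congr e ?_)).symm
  intro a b
  change σ.SameCycle a b ↔ (e.permCongr σ).SameCycle (e a) (e b)
  have hz : ∀ i : ℤ, ((e.permCongr σ) ^ i) (e a) = e ((σ ^ i) a) := by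
    intro i
    have := map_zpow (e.permCongrHom) σ i
    change e.permCongrHom (σ ^ i) = (e.permCongr σ) ^ i at this
    rw [← this]
    simp [Equiv.permCongrHom]
  simp [Perm.SameCycle, hz]

/-- The `α`-permanent type sum of the matrix `a` over all permutations of the index type. -/
noncomputable def permSum (α : ℂ) (V : Type*) [Fintype V] [DecidableEq V] (a : V → V → ℂ) : ℂ :=
  ∑ σ : Perm V, α ^ (Fintype.card V - σ.partition.parts.card) * ∏ v, a v (σ v)

theorem permSum_congr (α : ℂ) (e : V ≃ W) (a : W → W → ℂ) :
    permSum α V (fun v w => a (e v) (e w)) = permSum α W a := by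
  unfold permSum
  refine Fintype.sum_equiv e.permCongr _ _ fun σ => ?_
  rw [card_parts_partition_congr]
  congr 1
  · have h := Fintype.card_congr e
    congr 2
  refine Fintype.prod_equiv e _ _ fun v => ?_
  simp

/-- Permutations preserving the fibres of `f` are families of permutations of the fibres. -/
noncomputable def permFibersEquiv {T : Type*} (f : V → T) :
    {σ : Perm V // ∀ v, f (σ v) = f v} ≃ (∀ i, Perm {v // f v = i}) :=
  Equiv.ofBijective (fun σ i => σ.1.subtypePerm (fun v => by rw [σ.2 v])) <| by
    constructor
    · intro σ τ h
      ext v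
      have := congrArg (fun g => ((g (f v)) ⟨v, rfl⟩ : {w // f w = f v}).1) h
      simpa using this
    · intro τ
      let σ : Perm V := (Equiv.sigmaFiberEquiv f).symm.trans
        ((Equiv.sigmaCongrRight τ).trans (Equiv.sigmaFiberEquiv f))
      have hσ : ∀ v, σ v = (τ (f v) ⟨v, rfl⟩).1 := fun v => rfl
      refine ⟨⟨σ, fun v => by rw [hσ]; exact (τ (f v) ⟨v, rfl⟩).2⟩, ?_⟩
      funext i
      ext ⟨v, hv⟩
      subst hv
      simp [hσ]

omit [Fintype V] [DecidableEq V] in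
theorem permFibersEquiv_apply {T : Type*} (f : V → T) (σ : {σ : Perm V // ∀ v, f (σ v) = f v})
    (i : T) (v : {v // f v = i}) : ((permFibersEquiv f σ i) v).1 = σ.1 v.1 := rfl

omit [Fintype V] [DecidableEq V] in
theorem apply_eq_apply_of_sameCycle {T : Type*} {σ : Perm V} {f : V → T}
    (hf : ∀ v, f (σ v) = f v) {v w : V} (h : σ.SameCycle v w) : f v = f w := by
  have h1 : ∀ (n : ℕ) v, f ((σ ^ n) v) = f v := by
    intro n
    induction n with
    | zero => simp
    | succ n ih => intro v; rw [pow_succ, Perm.mul_apply, ih, hf]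
  obtain ⟨n, rfl⟩ := h
  cases n with
  | ofNat n => simp [h1]
  | negSucc n =>
    have := h1 (n + 1) ((σ ^ (n + 1))⁻¹ v)
    rw [← Perm.mul_apply, mul_inv_cancel, Perm.one_apply] at this
    rw [zpow_negSucc, this]

/-- A permutation preserving `f` has each orbit inside one fibre. -/
theorem card_parts_partition_fibers {T : Type*} [Fintype T] [DecidableEq T] (f : V → T)
    (σ : {σ : Perm V // ∀ v, f (σ v) = f v}) :
    ∑ i, (permFibersEquiv f σ i).partition.parts.card = σ.1.partition.parts.card := by
  classical
  simp_rw [card_parts_partition_eq_card_quotient]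
  rw [← Fintype.card_sigma]
  have hz : ∀ (i : T) (v w : {v // f v = i}),
      (permFibersEquiv f σ i).SameCycle v w ↔ σ.1.SameCycle v.1 w.1 :=
    fun i v w => Perm.sameCycle_subtypePerm (h := fun v => by rw [σ.2 v])
  have hf : ∀ v w, σ.1.SameCycle v w → f v = f w :=
    fun v w => apply_eq_apply_of_sameCycle σ.2
  refine Fintype.card_of_bijective
    (f := fun s => Quotient.map' (s₁ := Perm.SameCycle.setoid (permFibersEquiv f σ s.1))
      (s₂ := Perm.SameCycle.setoid σ.1) Subtype.val
      (fun v w h => (hz s.1 v w).1 h) s.2) ⟨?_, ?_⟩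
  · rintro ⟨i, ⟨v, hv⟩⟩ ⟨j, ⟨w, hw⟩⟩ h
    have h' : σ.1.SameCycle v w := Quotient.exact h
    have hij : i = j := by rw [← hv, ← hw]; exact hf v w h'
    subst hij
    refine congrArg (Sigma.mk i) ?_
    exact Quotient.sound ((hz i ⟨v, hv⟩ ⟨w, hw⟩).2 h')
  · rintro ⟨v⟩
    exact ⟨⟨f v, Quotient.mk _ ⟨v, rfl⟩⟩, rfl⟩

theorem prod_permSum_fibers (α : ℂ) {T : Type*} [Fintype T] [DecidableEq T] (f : V → T)
    (a : V → V → ℂ) :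
    ∏ i, permSum α {v // f v = i} (fun v w => a v.1 w.1) =
      ∑ σ : {σ : Perm V // ∀ v, f (σ v) = f v},
        α ^ (Fintype.card V - σ.1.partition.parts.card) * ∏ v, a v (σ.1 v) := by
  classical
  unfold permSum
  rw [Fintype.prod_sum]
  symm
  refine Fintype.sum_equiv (permFibersEquiv f) _ _ fun σ => ?_
  rw [Finset.prod_mul_distrib, Finset.prod_pow_eq_pow_sum]
  congr 1
  · congr 1
    -- The truncated differences add up because no permutation has more cycles than points.
    rw [← card_parts_partition_fibers f σ, Finset.sum_tsub_distrib]
    · congr 1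
      rw [← Fintype.card_sigma]
      exact Fintype.card_congr (Equiv.sigmaFiberEquiv f).symm
    · intro i _
      exact card_parts_partition_le _
  · rw [← Fintype.prod_sigma' (f := fun i v => a v.1 ((permFibersEquiv f σ i) v).1)]
    exact (Fintype.prod_equiv (Equiv.sigmaFiberEquiv f) _ _ fun s => by
      simp [permFibersEquiv_apply]).symm

/-- An invariant colouring is an arbitrary colouring of the set of orbits. -/
theorem card_invariant_functions (σ : Perm V) (t : ℕ) :
    Fintype.card {f : V → Fin t // ∀ v, f (σ v) = f v} = t ^ σ.partition.parts.card := by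
  classical
  rw [card_parts_partition_eq_card_quotient]
  have : t ^ Fintype.card (Quotient (Perm.SameCycle.setoid σ)) =
      Fintype.card (Quotient (Perm.SameCycle.setoid σ) → Fin t) := by simp
  rw [this]
  refine (Fintype.card_of_bijective (f := fun g => (⟨fun v => g (Quotient.mk _ v), fun v => ?_⟩ :
    {f : V → Fin t // ∀ v, f (σ v) = f v})) ⟨?_, ?_⟩).symm
  · refine congrArg g ?_
    exact Quotient.sound (s := Perm.SameCycle.setoid σ) (Perm.sameCycle_apply_left.2 (Perm.SameCycle.refl _ _))
  · intro g h hgh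
    funext q
    induction q using Quotient.ind with
    | _ v => exact congrFun (congrArg Subtype.val hgh) v
  · rintro ⟨f, hf⟩
    refine ⟨Quotient.lift f ?_, ?_⟩
    · exact fun v w h => apply_eq_apply_of_sameCycle hf h
    · rfl

/-- Exchange the sums: `σ` contributes once for each colouring constant on its cycles. -/
theorem sum_prod_permSum_fibers (α : ℂ) (a : V → V → ℂ) (t : ℕ) :
    ∑ f : V → Fin t, ∏ i, permSum α {v // f v = i} (fun v w => a v.1 w.1) =
      ∑ σ : Perm V, (α ^ (Fintype.card V - σ.partition.parts.card) * ∏ v, a v (σ v)) *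
        (t : ℂ) ^ σ.partition.parts.card := by
  classical
  simp_rw [prod_permSum_fibers]
  have h1 : ∀ f : V → Fin t, ∑ σ : {σ : Perm V // ∀ v, f (σ v) = f v},
        α ^ (Fintype.card V - σ.1.partition.parts.card) * ∏ v, a v (σ.1 v) =
      ∑ σ : Perm V, if ∀ v, f (σ v) = f v then
        α ^ (Fintype.card V - σ.partition.parts.card) * ∏ v, a v (σ v) else 0 := by
    intro f
    rw [← Finset.sum_filter]
    exact (Finset.sum_subtype (p := fun σ : Perm V => ∀ v, f (σ v) = f v)
      (Finset.univ.filter fun σ : Perm V => ∀ v, f (σ v) = f v) (fun σ => by simp)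
      (fun σ => α ^ (Fintype.card V - σ.partition.parts.card) * ∏ v, a v (σ v))).symm
  simp_rw [h1]
  rw [Finset.sum_comm]
  refine Finset.sum_congr rfl fun σ _ => ?_
  rw [← Finset.sum_filter, Finset.sum_const, nsmul_eq_mul, mul_comm]
  congr 1
  rw [← Fintype.card_subtype, card_invariant_functions]
  push_cast; rfl

/-- The functions on `V` are the pairs of a partition and an injective labelling of its blocks. -/
theorem bijective_partition_labelling (t : ℕ) : Function.Bijective
    (fun (s : Σ π : Finpartition (Finset.univ : Finset V), (π.parts ↪ Fin t)) (v : V) =>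
      s.2 ⟨s.1.part v, s.1.part_mem.2 (Finset.mem_univ v)⟩) := by
  classical
  constructor
  · rintro ⟨π, g⟩ ⟨π', g'⟩ h
    have h' : ∀ v, g ⟨π.part v, π.part_mem.2 (Finset.mem_univ v)⟩ =
        g' ⟨π'.part v, π'.part_mem.2 (Finset.mem_univ v)⟩ := fun v => congrFun h v
    have hpart : ∀ v w, π.part v = π.part w ↔ π'.part v = π'.part w := by
      intro v w
      have e1 := h' v
      have e2 := h' w
      constructor
      · intro hvw
        have : g ⟨π.part v, π.part_mem.2 (Finset.mem_univ v)⟩ =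
          g ⟨π.part w, π.part_mem.2 (Finset.mem_univ w)⟩ := by simp [hvw]
        rw [e1, e2] at this
        simpa using g'.injective this
      · intro hvw
        have : g' ⟨π'.part v, π'.part_mem.2 (Finset.mem_univ v)⟩ =
          g' ⟨π'.part w, π'.part_mem.2 (Finset.mem_univ w)⟩ := by simp [hvw]
        rw [← e1, ← e2] at this
        simpa using g.injective this
    have hpe : ∀ v, π.part v = π'.part v := by
      intro v
      ext w
      rw [π.mem_part_iff_part_eq_part (Finset.mem_univ _) (Finset.mem_univ _),
        π'.mem_part_iff_part_eq_part (Finset.mem_univ _) (Finset.mem_univ _), hpart]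
    have hππ : π = π' := by
      ext I
      constructor
      · intro hI
        obtain ⟨v, hv⟩ := π.nonempty_of_mem_parts hI
        rw [← π.part_eq_of_mem hI hv, hpe]
        exact π'.part_mem.2 (Finset.mem_univ _)
      · intro hI
        obtain ⟨v, hv⟩ := π'.nonempty_of_mem_parts hI
        rw [← π'.part_eq_of_mem hI hv, ← hpe]
        exact π.part_mem.2 (Finset.mem_univ _)
    subst hππ
    refine congrArg (Sigma.mk π) ?_
    ext ⟨I, hI⟩
    obtain ⟨v, hv⟩ := π.nonempty_of_mem_parts hI
    have := h' v
    simp only [π.part_eq_of_mem hI hv] at this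
    exact congrArg Fin.val this
  · intro f
    let π : Finpartition (Finset.univ : Finset V) := Finpartition.ofSetoid (Setoid.ker f)
    have hπ : ∀ v w, w ∈ π.part v ↔ f v = f w := fun v w =>
      Finpartition.mem_part_ofSetoid_iff_rel
    have hne : ∀ I : π.parts, I.1.Nonempty := fun I => π.nonempty_of_mem_parts I.2
    refine ⟨⟨π, ⟨fun I => f (hne I).choose, ?_⟩⟩, ?_⟩
    · intro I J hIJ
      have h1 := (hne I).choose_spec
      have h2 := (hne J).choose_spec
      have h3 := (hπ _ _).2 hIJ
      rw [π.part_eq_of_mem I.2 h1] at h3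
      exact Subtype.ext (π.eq_of_mem_parts I.2 J.2 h3 h2)
    · funext v
      have h1 := (hne ⟨π.part v, π.part_mem.2 (Finset.mem_univ v)⟩).choose_spec
      exact ((hπ _ _).1 h1).symm

/-- Group the colourings by their partition into colour classes. Unused colours contribute `M ∅ =
1`, and the descending factorial counts the injective labellings of the blocks. -/
theorem sum_prod_fibers_eq_sum_finpartition (M : Finset V → ℂ) (hM : M ∅ = 1) (t : ℕ) :
    ∑ f : V → Fin t, ∏ i, M (Finset.univ.filter fun v => f v = i) =
      ∑ π : Finpartition (Finset.univ : Finset V),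
        (t.descFactorial π.parts.card : ℂ) * ∏ I ∈ π.parts, M I := by
  classical
  rw [← Function.Bijective.sum_comp (bijective_partition_labelling t), Fintype.sum_sigma]
  refine Finset.sum_congr rfl fun π _ => ?_
  have key : ∀ g : π.parts ↪ Fin t, ∏ i, M (Finset.univ.filter fun v =>
      g ⟨π.part v, π.part_mem.2 (Finset.mem_univ v)⟩ = i) = ∏ I ∈ π.parts, M I := by
    intro g
    rw [← Finset.prod_coe_sort π.parts M]
    symm
    refine Fintype.prod_of_injective g g.injective _ _ ?_ ?_
    · intro i hi
      rw [Finset.filter_eq_empty_iff.2, hM]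
      intro v _ h
      exact hi ⟨_, h⟩
    · rintro ⟨I, hI⟩
      congr 1
      ext v
      simp [π.part_eq_iff_mem hI]
  simp only [key, Finset.sum_const, Finset.card_univ, Fintype.card_embedding_eq, Fintype.card_fin,
    Fintype.card_coe, nsmul_eq_mul]

/-- Since `descPochhammer (n + 1)` is `X` times `descPochhammer n` composed with `X - 1`, the
coefficient is the value of `descPochhammer n` at `-1`. -/
theorem coeff_one_descPochhammer (n : ℕ) :
    (descPochhammer ℂ (n + 1)).coeff 1 = (-1) ^ n * (n.factorial : ℂ) := by
  have h : ∀ n : ℕ, (descPochhammer ℂ n).eval (-1) = (-1) ^ n * (n.factorial : ℂ) := by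
    intro n
    induction n with
    | zero => simp
    | succ n ih =>
      rw [descPochhammer_succ_right, Polynomial.eval_mul, ih, Nat.factorial_succ]
      simp; ring
  rw [descPochhammer_succ_left, Polynomial.coeff_X_mul, Polynomial.coeff_zero_eq_eval_zero,
    Polynomial.eval_comp, ← h]
  simp

/-- The moment-to-cumulant formula for `α`-determinants: only cyclic permutations remain. -/
theorem sum_finpartition_permSum [Nonempty V] (α : ℂ) (a : V → V → ℂ) :
    ∑ π : Finpartition (Finset.univ : Finset V),
      (-1 : ℂ) ^ (π.parts.card - 1) * ((π.parts.card - 1).factorial : ℂ) *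
        ∏ I ∈ π.parts, permSum α I (fun v w => a v.1 w.1) =
    ∑ σ : Perm V with σ.partition.parts.card = 1,
      α ^ (Fintype.card V - 1) * ∏ v, a v (σ v) := by
  classical
  let M : Finset V → ℂ := fun I => permSum α I (fun v w => a v.1 w.1)
  have hM : M ∅ = 1 := by
    simp [M, permSum]
  have hfib : ∀ (t : ℕ) (f : V → Fin t) (i : Fin t),
      M (Finset.univ.filter fun v => f v = i) =
        permSum α {v // f v = i} (fun v w => a v.1 w.1) := by
    intro t f i
    exact permSum_congr α (Equiv.subtypeEquivRight (by simp) :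
      {v // v ∈ Finset.univ.filter fun v => f v = i} ≃ {v // f v = i}) (fun v w => a v.1 w.1)
  -- `p` and `q` are the two counts of coloured configurations, as polynomials in the number of
  -- colours; they agree at every natural number.
  let p : Polynomial ℂ := ∑ π : Finpartition (Finset.univ : Finset V),
    Polynomial.C (∏ I ∈ π.parts, M I) * descPochhammer ℂ π.parts.card
  let q : Polynomial ℂ := ∑ σ : Perm V,
    Polynomial.C (α ^ (Fintype.card V - σ.partition.parts.card) * ∏ v, a v (σ v)) *
      Polynomial.X ^ σ.partition.parts.card
  have hpq : p = q := by
    refine Polynomial.eq_of_infinite_eval_eq p q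
      (Set.Infinite.mono ?_ (Set.infinite_range_of_injective (Nat.cast_injective (R := ℂ))))
    rintro _ ⟨t, rfl⟩
    have h1 := sum_prod_fibers_eq_sum_finpartition M hM t
    simp_rw [hfib, sum_prod_permSum_fibers] at h1
    simp only [p, q, Set.mem_ofPred_eq, Polynomial.eval_finsetSum, Polynomial.eval_mul,
      Polynomial.eval_C, Polynomial.eval_pow, Polynomial.eval_X,
      descPochhammer_eval_eq_descFactorial]
    rw [h1]
    exact Finset.sum_congr rfl fun π _ => mul_comm _ _
  have h2 := congrArg (fun r : Polynomial ℂ => r.coeff 1) hpq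
  simp only [p, q, Polynomial.finsetSum_coeff, Polynomial.coeff_C_mul,
    Polynomial.coeff_X_pow] at h2
  have h3 : ∀ π : Finpartition (Finset.univ : Finset V), (descPochhammer ℂ π.parts.card).coeff 1 =
      (-1 : ℂ) ^ (π.parts.card - 1) * ((π.parts.card - 1).factorial : ℂ) := by
    intro π
    have : 0 < π.parts.card := Finset.card_pos.2 (π.parts_nonempty
      Finset.univ_nonempty.ne_empty)
    obtain ⟨n, hn⟩ := Nat.exists_eq_succ_of_ne_zero this.ne'
    rw [hn, Nat.succ_eq_add_one, coeff_one_descPochhammer]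
    simp
  simp_rw [h3] at h2
  rw [Finset.sum_filter]
  calc _ = _ := Finset.sum_congr rfl fun π _ => mul_comm _ _
    _ = _ := h2
    _ = _ := by
      refine Finset.sum_congr rfl fun σ _ => ?_
      by_cases h : σ.partition.parts.card = 1
      · simp [h]
      · simp [h, Ne.symm h]

end Combinatorics

/-! ### Factorial moments over arbitrary index types and Fubini over blocks -/

section Density

variable {d : ℕ} {Ω : Type*} [MeasurableSpace Ω]

theorem factorialMoment_congr (P : Measure Ω) (η : Ω → LocFinSet d) {ι ι' : Type*} (e : ι ≃ ι')
    (B : Set (ι → E d)) :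
    factorialMoment P η {x : ι' → E d | x ∘ e ∈ B} = factorialMoment P η B := by
  unfold factorialMoment
  refine lintegral_congr fun ω => ?_
  congr 1
  have hinj : Function.Injective (fun x : ι' → E d => x ∘ e) := e.surjective.injective_comp_right
  rw [← hinj.encard_image]
  congr 1
  ext x
  constructor
  · rintro ⟨y, ⟨⟨hy1, hy2⟩, hy3⟩, rfl⟩
    exact ⟨⟨hy1.comp e.injective, fun i => hy2 _⟩, hy3⟩
  · rintro ⟨⟨hx1, hx2⟩, hx3⟩
    refine ⟨x ∘ e.symm, ⟨⟨hx1.comp e.symm.injective, fun i => hx2 _⟩, ?_⟩, ?_⟩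
    · change (x ∘ e.symm) ∘ e ∈ B
      simpa [Function.comp_assoc] using hx3
    · simp [Function.comp_assoc]

/-- Blocks of a partition are index types other than `Fin n`. Any enumeration `e` serves, without
appeal to the symmetry of `ρ`. -/
theorem IsCorrelationFunction.factorialMoment_eq {P : Measure Ω} {η : Ω → LocFinSet d} {n : ℕ}
    {ρ : (Fin n → E d) → ℝ≥0} (hρ : IsCorrelationFunction P η n ρ) {ι : Type*} [Fintype ι]
    (e : ι ≃ Fin n) {B : Set (ι → E d)} (hB : MeasurableSet B) :
    factorialMoment P η B = ∫⁻ x in B, (ρ (fun j => x (e.symm j)) : ℝ≥0∞) := by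
  have hmeas : Measurable fun x : Fin n → E d => x ∘ e := by
    refine measurable_pi_lambda _ fun i => ?_
    exact measurable_pi_apply (e i)
  rw [← factorialMoment_congr P η e B, hρ.2 {x | x ∘ e ∈ B} (hmeas hB)]
  have hmp := volume_measurePreserving_piCongrLeft (fun _ : ι => E d) e.symm
  have happ : ∀ x : Fin n → E d, MeasurableEquiv.piCongrLeft (fun _ : ι => E d) e.symm x = x ∘ e := by
    intro x
    funext i
    have := Equiv.piCongrLeft_apply_apply (fun _ : ι => E d) e.symm x (e i)
    rw [Equiv.symm_apply_apply] at this
    exact this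
  rw [← hmp.setLIntegral_comp_preimage_emb (MeasurableEquiv.measurableEmbedding _)]
  have hset : {x : Fin n → E d | x ∘ e ∈ B} =
      (MeasurableEquiv.piCongrLeft (fun _ : ι => E d) e.symm) ⁻¹' B := by
    ext x; simp [happ]
  rw [hset]
  refine lintegral_congr fun x => ?_
  rw [happ]
  congr 2
  funext j
  simp

/-- Product integrals over the blocks of a partition of the coordinates. -/
theorem integral_prod_sigma {X : Type*} [MeasureSpace X] [SigmaFinite (volume : Measure X)]
    {T V : Type*} [Fintype T] [Fintype V] {κ : T → Type*} [∀ i, Fintype (κ i)]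
    (e : (Σ i, κ i) ≃ V) (g : ∀ i, (κ i → X) → ℝ) :
    ∫ x : V → X, ∏ i, g i (fun k => x (e ⟨i, k⟩)) = ∏ i, ∫ y, g i y := by
  rw [← integral_fintype_prod_volume_eq_prod]
  have h1 := volume_measurePreserving_piCongrLeft (fun _ : V => X) e
  rw [← h1.integral_comp (MeasurableEquiv.measurableEmbedding _)]
  have happ : ∀ (x : (Σ i, κ i) → X) s,
      MeasurableEquiv.piCongrLeft (fun _ : V => X) e x (e s) = x s :=
    fun x s => Equiv.piCongrLeft_apply_apply (fun _ : V => X) e x s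
  simp_rw [happ]
  -- Uncurrying preserves volume: the two product measures agree on boxes.
  let c := (MeasurableEquiv.piCurry (fun (i : T) (_ : κ i) => X)).symm
  have h2 : MeasurePreserving c := by
    refine ⟨c.measurable, ?_⟩
    symm
    refine Measure.pi_eq fun s hs => ?_
    rw [c.map_apply]
    have : c ⁻¹' Set.univ.pi s = Set.univ.pi fun i => Set.univ.pi fun k => s ⟨i, k⟩ := by
      ext y
      simp only [c, Set.mem_preimage, Set.mem_pi, Set.mem_univ, true_imp_iff]
      exact ⟨fun h i k => h ⟨i, k⟩, fun h s => h s.1 s.2⟩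
    rw [this]
    simp only [volume_pi_pi]
    exact (Fintype.prod_sigma fun s' => volume (s s')).symm
  rw [← h2.integral_comp (MeasurableEquiv.measurableEmbedding _)]
  rfl

theorem integral_prod_parts {X : Type*} [MeasureSpace X] [SigmaFinite (volume : Measure X)]
    {V : Type*} [Fintype V] [DecidableEq V] (π : Finpartition (Finset.univ : Finset V))
    (g : ∀ I : Finset V, (I → X) → ℝ) :
    ∫ x : V → X, ∏ I ∈ π.parts, g I (fun k => x k) = ∏ I ∈ π.parts, ∫ y, g I y := by
  let e : (Σ I : π.parts, I.1) ≃ V := Equiv.ofBijective (fun s => s.2.1) <| by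
    constructor
    · rintro ⟨⟨I, hI⟩, ⟨v, hv⟩⟩ ⟨⟨J, hJ⟩, ⟨w, hw⟩⟩ h
      simp only at h hv hw
      subst h
      have := π.eq_of_mem_parts hI hJ hv hw
      subst this
      rfl
    · intro v
      exact ⟨⟨⟨π.part v, π.part_mem.2 (Finset.mem_univ v)⟩,
        ⟨v, π.mem_part_self.2 (Finset.mem_univ v)⟩⟩, rfl⟩
  have := integral_prod_sigma (X := X) e (fun I => g I.1)
  rw [Finset.prod_coe_sort π.parts (fun I => ∫ y, g I y)] at this
  rw [← this]
  congr 1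
  funext x
  rw [← Finset.prod_coe_sort π.parts]
  rfl

end Density

/-! ### Signed measures with bounded density -/

namespace LocFinSignedMeasure

/-- The signed measure with a bounded measurable density. -/
noncomputable def ofDensity {X : Type*} [MeasureSpace X] [Bornology X]
    (hvol : ∀ B : Set X, Bornology.IsBounded B → volume B < ∞)
    (f : X → ℝ) (hf : Measurable f) (C : ℝ) (hC : ∀ x, |f x| ≤ C) : LocFinSignedMeasure X where
  pos := volume.withDensity fun x => ENNReal.ofReal (f x)
  neg := volume.withDensity fun x => ENNReal.ofReal (-f x)
  pos_lt_top B hB := by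
    refine lt_of_le_of_lt (Measure.le_iff'.1 (withDensity_mono (ae_of_all _ fun x =>
      ENNReal.ofReal_le_ofReal ((le_abs_self _).trans (hC x)))) B) ?_
    rw [withDensity_const]
    exact ENNReal.mul_lt_top ENNReal.ofReal_lt_top (hvol B hB)
  neg_lt_top B hB := by
    refine lt_of_le_of_lt (Measure.le_iff'.1 (withDensity_mono (ae_of_all _ fun x =>
      ENNReal.ofReal_le_ofReal ((neg_le_abs _).trans (hC x)))) B) ?_
    rw [withDensity_const]
    exact ENNReal.mul_lt_top ENNReal.ofReal_lt_top (hvol B hB)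
  mutuallySingular := by
    have hs : MeasurableSet {x | f x ≤ 0} := measurableSet_le hf measurable_const
    refine ⟨{x | f x ≤ 0}, hs, ?_, ?_⟩
    · rw [withDensity_apply _ hs, setLIntegral_eq_zero_iff hs hf.ennreal_ofReal]
      exact ae_of_all _ fun x hx => ENNReal.ofReal_of_nonpos hx
    · rw [withDensity_apply _ hs.compl, setLIntegral_eq_zero_iff hs.compl
        (f := fun x => ENNReal.ofReal (-f x)) hf.neg.ennreal_ofReal]
      refine ae_of_all _ fun x hx => ENNReal.ofReal_of_nonpos ?_
      simp only [Set.mem_compl_iff, Set.mem_ofPred_eq, not_le] at hx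
      linarith

variable {X : Type*} [MeasureSpace X] [Bornology X]
    (hvol : ∀ B : Set X, Bornology.IsBounded B → volume B < ∞)
    {f : X → ℝ} (hf : Measurable f) {C : ℝ} (hC : ∀ x, |f x| ≤ C)

theorem integrableOn_density (hvol : ∀ B : Set X, Bornology.IsBounded B → volume B < ∞)
    {f : X → ℝ} (hf : Measurable f) {C : ℝ} (hC : ∀ x, |f x| ≤ C) {B : Set X} (hB : Bornology.IsBounded B) : IntegrableOn f B := by
  refine Measure.integrableOn_of_bounded (hvol B hB).ne hf.aestronglyMeasurable (M := C) ?_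
  exact ae_of_all _ hC

theorem value_ofDensity {B : Set X} (hBm : MeasurableSet B) (hB : Bornology.IsBounded B) :
    (ofDensity hvol f hf C hC).value B = ∫ x in B, f x := by
  rw [integral_eq_lintegral_pos_part_sub_lintegral_neg_part
    (integrableOn_density hvol hf hC hB)]
  unfold value ofDensity Measure.real
  simp only
  rw [withDensity_apply _ hBm, withDensity_apply _ hBm]

theorem lintegral_totalVariation_ofDensity {g : X → ℝ≥0∞} (hg : Measurable g) :
    ∫⁻ x, g x ∂(ofDensity hvol f hf C hC).totalVariation = ∫⁻ x, ENNReal.ofReal |f x| * g x := by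
  unfold totalVariation ofDensity
  rw [lintegral_add_measure, lintegral_withDensity_eq_lintegral_mul _ hf.ennreal_ofReal hg,
    lintegral_withDensity_eq_lintegral_mul _
      (f := fun x => ENNReal.ofReal (-f x)) hf.neg.ennreal_ofReal hg, ← lintegral_add_left
    (hf.ennreal_ofReal.mul hg)]
  refine lintegral_congr fun x => ?_
  simp only [Pi.mul_apply]
  rw [← add_mul]
  congr 1
  rcases le_total 0 (f x) with h | h
  · rw [abs_of_nonneg h, ENNReal.ofReal_of_nonpos (p := -f x) (by linarith), add_zero]
  · rw [abs_of_nonpos h, ENNReal.ofReal_of_nonpos h, zero_add]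

end LocFinSignedMeasure

/-! ### The density of the factorial cumulant measure -/

section CumulantDensity

variable {d : ℕ} {Ω : Type*} [MeasurableSpace Ω]

theorem alphaDet_eq_permSum (α : ℝ) (K : E d → E d → ℂ) (n : ℕ) (x : Fin n → E d) :
    alphaDet α K n x = permSum (α : ℂ) (Fin n) (fun i j => K (x i) (x j)) := by
  unfold alphaDet permSum
  refine Finset.sum_congr rfl fun σ _ => ?_
  have h := Fintype.card_fin n
  congr 3
  exact h.symm

theorem continuous_alphaDet (α : ℝ) {K : E d → E d → ℂ}
    (hK : Continuous fun p : E d × E d => K p.1 p.2) (n : ℕ) : Continuous (alphaDet α K n) := by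
  unfold alphaDet
  refine continuous_finsetSum _ fun σ _ => continuous_const.mul
    (continuous_finsetProd _ fun j _ => ?_)
  have h : Continuous fun x : Fin n → E d => (x j, x (σ j)) := by fun_prop
  exact hK.comp h

theorem exists_norm_alphaDet_le (α : ℝ) {K : E d → E d → ℂ}
    (hK : ∃ c : ℝ, ∀ x y, ‖K x y‖ ≤ c) (n : ℕ) : ∃ C : ℝ, ∀ x, ‖alphaDet α K n x‖ ≤ C := by
  obtain ⟨c, hc⟩ := hK
  refine ⟨∑ σ : Equiv.Perm (Fin n), ‖(α : ℂ) ^ (n - σ.partition.parts.card)‖ * ∏ _j : Fin n, c,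
    fun x => ?_⟩
  unfold alphaDet
  refine (norm_sum_le _ _).trans (Finset.sum_le_sum fun σ _ => ?_)
  rw [norm_mul, norm_prod]
  gcongr
  exact hc _ _

/-- The correlation function evaluated at the points indexed by the block `I`. -/
noncomputable def blockDensity (ρ : ∀ n, (Fin n → E d) → ℝ≥0) {V : Type*} (I : Finset V)
    (y : I → E d) : ℝ :=
  ρ I.card fun j => y (I.equivFin.symm j)

/-- The density of the factorial cumulant measure in terms of the correlation functions. -/
noncomputable def cumulantDensity (ρ : ∀ n, (Fin n → E d) → ℝ≥0) (m : ℕ) (x : Fin m → E d) : ℝ :=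
  ∑ π : Finpartition (Finset.univ : Finset (Fin m)),
    (-1 : ℝ) ^ (π.parts.card - 1) * ((π.parts.card - 1).factorial : ℝ) *
      ∏ I ∈ π.parts, blockDensity ρ I fun i => x i

variable {ρ : ∀ n, (Fin n → E d) → ℝ≥0}

theorem continuous_blockDensity (hc : ∀ n, 1 ≤ n → Continuous (ρ n)) {V : Type*} {I : Finset V}
    (hI : I.Nonempty) : Continuous (blockDensity ρ I) := by
  unfold blockDensity
  refine NNReal.continuous_coe.comp ((hc _ hI.card_pos).comp ?_)
  exact continuous_pi fun j => continuous_apply _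

theorem continuous_cumulantDensity (hc : ∀ n, 1 ≤ n → Continuous (ρ n)) (m : ℕ) :
    Continuous (cumulantDensity ρ m) := by
  unfold cumulantDensity
  refine continuous_finsetSum _ fun π _ => continuous_const.mul
    (continuous_finsetProd _ fun I hI => ?_)
  exact (continuous_blockDensity hc (π.nonempty_of_mem_parts hI)).comp
    (continuous_pi fun i => continuous_apply _)

theorem cumulantDensity_add (hinv : ∀ n, 1 ≤ n → ∀ x z, ρ n (fun i => x i + z) = ρ n x) (m : ℕ)
    (x : Fin m → E d) (z : E d) :
    cumulantDensity ρ m (fun i => x i + z) = cumulantDensity ρ m x := by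
  unfold cumulantDensity blockDensity
  refine Finset.sum_congr rfl fun π _ => ?_
  congr 1
  refine Finset.prod_congr rfl fun I hI => ?_
  rw [hinv _ (π.nonempty_of_mem_parts hI).card_pos (fun j => x (I.equivFin.symm j)) z]

theorem cumulantDensity_eq_sum_cyclic {α : ℝ} {K : E d → E d → ℂ}
    (hρ : ∀ n, 1 ≤ n → ∀ x, ((ρ n x : ℝ) : ℂ) = alphaDet α K n x) {m : ℕ} (hm : 1 ≤ m)
    (x : Fin m → E d) :
    (cumulantDensity ρ m x : ℂ) = ∑ σ : Equiv.Perm (Fin m) with σ.partition.parts.card = 1,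
      (α : ℂ) ^ (m - 1) * ∏ j, K (x j) (x (σ j)) := by
  have : Nonempty (Fin m) := ⟨⟨0, hm⟩⟩
  have h := sum_finpartition_permSum (α : ℂ) (fun i j : Fin m => K (x i) (x j))
  refine Eq.trans ?_ (h.trans (Finset.sum_congr rfl fun σ _ => by
    congr 3; exact Fintype.card_fin m))
  unfold cumulantDensity blockDensity
  push_cast
  refine Finset.sum_congr rfl fun π _ => ?_
  congr 1
  refine Finset.prod_congr rfl fun I hI => ?_
  rw [hρ _ (π.nonempty_of_mem_parts hI).card_pos, alphaDet_eq_permSum]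
  exact permSum_congr (α : ℂ) I.equivFin.symm (fun v w => K (x v) (x w))

theorem exists_abs_cumulantDensity_le {α : ℝ} {K : E d → E d → ℂ}
    (hρ : ∀ n, 1 ≤ n → ∀ x, ((ρ n x : ℝ) : ℂ) = alphaDet α K n x)
    (hK : ∃ c : ℝ, ∀ x y, ‖K x y‖ ≤ c) {m : ℕ} (hm : 1 ≤ m) :
    ∃ C, ∀ x, |cumulantDensity ρ m x| ≤ C := by
  obtain ⟨c, hc⟩ := hK
  refine ⟨∑ σ : Equiv.Perm (Fin m) with σ.partition.parts.card = 1,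
    ‖(α : ℂ) ^ (m - 1)‖ * ∏ _j : Fin m, c, fun x => ?_⟩
  rw [← Real.norm_eq_abs, ← Complex.norm_real, cumulantDensity_eq_sum_cyclic hρ hm]
  refine (norm_sum_le _ _).trans (Finset.sum_le_sum fun σ _ => ?_)
  rw [norm_mul, norm_prod]
  gcongr
  exact hc _ _

theorem volume_pi_lt_top_of_isBounded {n : ℕ} (B : Set (Fin n → E d))
    (hB : Bornology.IsBounded B) : volume B < ∞ := hB.measure_lt_top

theorem toReal_factorialMoment_block {P : Measure Ω} {η : Ω → LocFinSet d}
    (hρ : ∀ n, 1 ≤ n → IsCorrelationFunction P η n (ρ n)) {V : Type*} {I : Finset V}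
    (hI : I.Nonempty) {B : Set (I → E d)} (hB : MeasurableSet B) :
    (factorialMoment P η B).toReal = ∫ y, B.indicator (blockDensity ρ I) y := by
  rw [(hρ _ hI.card_pos).factorialMoment_eq I.equivFin hB, integral_indicator hB,
    integral_eq_lintegral_of_nonneg_ae]
  · simp [blockDensity]
  · exact ae_of_all _ fun y => NNReal.coe_nonneg _
  · refine (Measurable.aestronglyMeasurable ?_)
    unfold blockDensity
    refine ((hρ _ hI.card_pos).1.comp ?_).coe_nnreal_real
    exact measurable_pi_lambda _ fun j => measurable_pi_apply _

/-- The indicator of a box factors over the blocks of each partition, so Fubini turns the product of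
block moments into one integral. -/
theorem factorialCumulant_eq_setIntegral {P : Measure Ω} {η : Ω → LocFinSet d}
    (hρ : ∀ n, 1 ≤ n → IsCorrelationFunction P η n (ρ n))
    (hc : ∀ n, 1 ≤ n → Continuous (ρ n)) (hb : ∀ n, 1 ≤ n → ∃ C : ℝ, ∀ x, (ρ n x : ℝ) ≤ C)
    (m : ℕ) (B : Fin m → Set (E d)) (hB : ∀ i, MeasurableSet (B i))
    (hBb : ∀ i, Bornology.IsBounded (B i)) :
    factorialCumulant P η m B = ∫ x in Set.univ.pi B, cumulantDensity ρ m x := by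
  have hBm : MeasurableSet (Set.univ.pi B) := MeasurableSet.univ_pi hB
  have hvol : volume (Set.univ.pi B) < ∞ :=
    volume_pi_lt_top_of_isBounded _ (Bornology.IsBounded.pi hBb)
  unfold factorialCumulant cumulantDensity
  rw [integral_finsetSum]
  · refine Finset.sum_congr rfl fun π _ => ?_
    rw [integral_const_mul]
    congr 1
    rw [← integral_indicator hBm]
    have h1 : ∀ I ∈ π.parts,
        (factorialMoment P η (Set.univ.pi fun i : I => B i.1)).toReal =
          ∫ y, (Set.univ.pi fun i : I => B i.1).indicator (blockDensity ρ I) y :=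
      fun I hI => toReal_factorialMoment_block hρ (π.nonempty_of_mem_parts hI)
        (MeasurableSet.univ_pi fun i => hB _)
    rw [Finset.prod_congr rfl h1, ← integral_prod_parts π
      (fun I y => (Set.univ.pi fun i : I => B i.1).indicator (blockDensity ρ I) y)]
    congr 1
    funext x
    by_cases hx : x ∈ Set.univ.pi B
    · rw [Set.indicator_of_mem hx]
      refine Finset.prod_congr rfl fun I _ => Set.indicator_of_mem ?_ _
      exact fun i _ => hx i.1 (Set.mem_univ _)
    · rw [Set.indicator_of_notMem hx]
      simp only [Set.mem_pi, Set.mem_univ, true_imp_iff, not_forall] at hx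
      -- If the coordinate `v` leaves its set, the factor of the block containing `v` vanishes.
      obtain ⟨v, hv⟩ := hx
      refine Finset.prod_eq_zero (π.part_mem.2 (Finset.mem_univ v)) (Set.indicator_of_notMem ?_ _)
      exact fun h => hv (h ⟨v, π.mem_part_self.2 (Finset.mem_univ v)⟩ (Set.mem_univ _))
  · intro π _
    refine Integrable.const_mul ?_ _
    choose! C hC using hb
    refine Measure.integrableOn_of_bounded hvol.ne ?_ (M := ∏ I ∈ π.parts, C I.card)
      (ae_of_all _ fun x => ?_)
    · refine Continuous.aestronglyMeasurable (continuous_finsetProd _ fun I hI => ?_)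
      exact (continuous_blockDensity hc (π.nonempty_of_mem_parts hI)).comp
        (continuous_pi fun i => continuous_apply _)
    · rw [norm_prod]
      refine Finset.prod_le_prod (fun _ _ => norm_nonneg _) fun I hI => ?_
      unfold blockDensity
      rw [Real.norm_of_nonneg (NNReal.coe_nonneg _)]
      exact hC _ (π.nonempty_of_mem_parts hI).card_pos _

end CumulantDensity

/-! ### Translation invariance of the correlation functions and of the modulus of the kernel -/

section Stationarity

variable {d : ℕ} {Ω : Type*} [MeasurableSpace Ω]

theorem LocFinSet.measurable_count {B : Set (E d)} (hB : MeasurableSet B) :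
    Measurable fun μ : LocFinSet d => μ.count B := by
  refine Measurable.of_comap_le ?_
  exact le_iSup (fun B : {B : Set (E d) // MeasurableSet B} =>
    MeasurableSpace.comap (fun μ : LocFinSet d => μ.count B.1) inferInstance) ⟨B, hB⟩

/-- Points of disjoint sets are automatically distinct. The tuple count becomes a product of counts,
hence a measurable function of the configuration, to which stationarity applies. -/
theorem encard_distinctTuples_pi {ι : Type*} [Fintype ι] (μ : LocFinSet d) (B : ι → Set (E d))
    (hB : Pairwise fun i j => Disjoint (B i) (B j)) :
    (distinctTuples ι μ ∩ Set.univ.pi B).encard = ∏ i, μ.count (B i) := by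
  unfold LocFinSet.count
  rw [← Set.encard_pi_eq_prod_encard]
  congr 1
  ext x
  simp only [distinctTuples, Set.mem_inter_iff, Set.mem_ofPred_eq, Set.mem_pi, Set.mem_univ,
    true_imp_iff]
  constructor
  · rintro ⟨⟨_, h1⟩, h2⟩ i
    exact ⟨h1 i, h2 i⟩
  · intro h
    refine ⟨⟨fun i j hij => ?_, fun i => (h i).1⟩, fun i => (h i).2⟩
    by_contra hne
    exact Set.disjoint_left.1 (hB hne) (h i).2 (hij ▸ (h j).2)

theorem count_shift (μ : LocFinSet d) (z : E d) (B : Set (E d)) :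
    (μ.shift z).count ((fun y => y + z) '' B) = μ.count B := by
  unfold LocFinSet.count LocFinSet.shift
  rw [← Set.image_inter (add_left_injective z), (add_left_injective z).encard_image]

theorem factorialMoment_pi_translate {P : Measure Ω} {η : Ω → LocFinSet d}
    (hstat : IsStationaryProcess P η) {ι : Type*} [Fintype ι] (B : ι → Set (E d))
    (hBm : ∀ i, MeasurableSet (B i)) (hB : Pairwise fun i j => Disjoint (B i) (B j)) (z : E d) :
    factorialMoment P η (Set.univ.pi fun i => (fun y => y + z) '' B i) =
      factorialMoment P η (Set.univ.pi B) := by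
  unfold factorialMoment
  have hB' : Pairwise fun i j => Disjoint ((fun y => y + z) '' B i) ((fun y => y + z) '' B j) :=
    fun i j hij => (Set.disjoint_image_iff (add_left_injective z)).2 (hB hij)
  have hBm' : ∀ i, MeasurableSet ((fun y => y + z) '' B i) := fun i =>
    (MeasurableEquiv.addRight z).measurableSet_image.2 (hBm i)
  simp_rw [encard_distinctTuples_pi _ _ hB, encard_distinctTuples_pi _ _ hB']
  have hmeas : Measurable fun μ : LocFinSet d =>
      ((∏ i, μ.count ((fun y => y + z) '' B i) : ℕ∞) : ℝ≥0∞) := by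
    refine (measurable_from_top (f := fun n : ℕ∞ => (n : ℝ≥0∞))).comp ?_
    exact Finset.measurable_fun_prod _ fun i _ => LocFinSet.measurable_count (hBm' i)
  have h := ((hstat z).comp hmeas).lintegral_eq
  simp only [Function.comp_def, count_shift] at h
  exact h.symm

/-- The diagonal is a proper linear subspace because `d ≥ 1`. -/
theorem volume_eq_coord_eq_zero (hd : 1 ≤ d) {n : ℕ} {i j : Fin n} (hij : i ≠ j) :
    volume {x : Fin n → E d | x i = x j} = 0 := by
  let S : Submodule ℝ (Fin n → E d) :=
    LinearMap.ker ((LinearMap.proj i : (Fin n → E d) →ₗ[ℝ] E d) - LinearMap.proj j)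
  have hS : {x : Fin n → E d | x i = x j} = S := by
    ext x
    simp [S, sub_eq_zero]
  rw [hS]
  refine Measure.addHaar_submodule _ S ?_
  intro h
  have : Nontrivial (E d) := by
    have : Nonempty (Fin d) := ⟨⟨0, hd⟩⟩
    infer_instance
  obtain ⟨v, hv⟩ := exists_ne (0 : E d)
  have hm : (Pi.single i v : Fin n → E d) ∈ S := by rw [h]; trivial
  have : (Pi.single i v : Fin n → E d) i = (Pi.single i v : Fin n → E d) j := by
    rw [← SetLike.mem_coe, ← hS] at hm
    exact hm
  rw [Pi.single_eq_same, Pi.single_eq_of_ne hij.symm] at this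
  exact hv this

theorem ae_injective (hd : 1 ≤ d) (n : ℕ) : ∀ᵐ x : Fin n → E d, Function.Injective x := by
  have h : ∀ᵐ x : Fin n → E d, ∀ i j : Fin n, i ≠ j → x i ≠ x j := by
    refine ae_all_iff.2 fun i => ae_all_iff.2 fun j => ?_
    by_cases hij : i = j
    · simp [hij]
    · have := volume_eq_coord_eq_zero hd hij
      filter_upwards [measure_eq_zero_iff_ae_notMem.1 this] with x hx _
      exact hx
  filter_upwards [h] with x hx i j hij
  by_contra hne
  exact hx i j hne hij

theorem le_of_setLIntegral_ball_le {X : Type*} [MeasureSpace X] [PseudoMetricSpace X]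
    [OpensMeasurableSpace X] [(volume : Measure X).IsOpenPosMeasure]
    (hfin : ∀ (x : X) r, volume (Metric.ball x r) < ∞) {f g : X → ℝ≥0} (hf : Continuous f)
    (hg : Continuous g) (x : X) {δ : ℝ} (hδ : 0 < δ)
    (h : ∀ r, 0 < r → r < δ → ∫⁻ y in Metric.ball x r, (f y : ℝ≥0∞) ≤
      ∫⁻ y in Metric.ball x r, (g y : ℝ≥0∞)) : f x ≤ g x := by
  by_contra! hlt
  -- Choose `g x < a < b < f x`; on a small ball `g < a` and `b < f`, which contradicts the integral
  -- inequality.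
  obtain ⟨a, ha1, ha2⟩ := exists_between hlt
  obtain ⟨b, hb1, hb2⟩ := exists_between ha2
  have h1 : ∀ᶠ y in nhds x, g y < a := hg.continuousAt.eventually_lt_const ha1
  have h2 : ∀ᶠ y in nhds x, b < f y := hf.continuousAt.eventually_const_lt hb2
  obtain ⟨ε, hε, hε'⟩ := Metric.eventually_nhds_iff_ball.1 (h1.and h2)
  obtain ⟨r, hr0, hr⟩ := exists_between (lt_min hε hδ)
  have hsub : Metric.ball x r ⊆ Metric.ball x ε :=
    Metric.ball_subset_ball (hr.trans_le (min_le_left _ _)).le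
  have hle := h r hr0 (hr.trans_le (min_le_right _ _))
  have h3 : (b : ℝ≥0∞) * volume (Metric.ball x r) ≤ ∫⁻ y in Metric.ball x r, (f y : ℝ≥0∞) := by
    rw [← setLIntegral_const]
    refine setLIntegral_mono' measurableSet_ball fun y hy => ?_
    exact_mod_cast (hε' y (hsub hy)).2.le
  have h4 : ∫⁻ y in Metric.ball x r, (g y : ℝ≥0∞) ≤ (a : ℝ≥0∞) * volume (Metric.ball x r) := by
    rw [← setLIntegral_const]
    refine setLIntegral_mono' measurableSet_ball fun y hy => ?_
    exact_mod_cast (hε' y (hsub hy)).1.le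
  have h5 := (h3.trans hle).trans h4
  rw [ENNReal.mul_le_mul_iff_left (Metric.measure_ball_pos _ _ hr0).ne' (hfin x r).ne] at h5
  exact absurd (ENNReal.coe_le_coe.1 h5) (not_le.2 hb1)

/-- Around a tuple of distinct points, small sup-norm balls are products of disjoint balls. Their
moments are translation invariant, and continuity recovers the values at the centre. -/
theorem correlation_translate_of_injective {P : Measure Ω} {η : Ω → LocFinSet d}
    (hstat : IsStationaryProcess P η) {n : ℕ} {ρ : (Fin n → E d) → ℝ≥0}
    (hρ : IsCorrelationFunction P η n ρ) (hc : Continuous ρ) (x : Fin n → E d)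
    (hx : Function.Injective x) (z : E d) : ρ (fun i => x i + z) = ρ x := by
  -- `δ` is half the least distance between two of the points, or `1` if there is no pair.
  obtain ⟨δ, hδ, hδ'⟩ : ∃ δ > 0, ∀ i j, i ≠ j → 2 * δ ≤ dist (x i) (x j) := by
    by_cases hne : ∃ i j : Fin n, i ≠ j
    · let S : Finset (Fin n × Fin n) := Finset.univ.filter fun p => p.1 ≠ p.2
      have hS : S.Nonempty := by
        obtain ⟨i, j, hij⟩ := hne
        exact ⟨(i, j), by simp [S, hij]⟩
      obtain ⟨p, hp, hmin⟩ := S.exists_min_image (fun p => dist (x p.1) (x p.2)) hS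
      refine ⟨dist (x p.1) (x p.2) / 2, half_pos (dist_pos.2 fun h => ?_), fun i j hij => ?_⟩
      · simp only [S, Finset.mem_filter] at hp
        exact hp.2 (hx h)
      · have := hmin (i, j) (by simp [S, hij])
        simp only at this
        linarith
    · push Not at hne
      exact ⟨1, one_pos, fun i j hij => absurd (hne i j) hij⟩
  have hmp : MeasurePreserving (fun y : Fin n → E d => fun i => y i + z) :=
    measurePreserving_add_right volume (fun _ => z)
  have hemb : MeasurableEmbedding (fun y : Fin n → E d => fun i => y i + z) :=
    (MeasurableEquiv.addRight (fun _ : Fin n => z)).measurableEmbedding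
  have hint : ∀ r, 0 < r → r < δ → ∫⁻ y in Metric.ball x r, (ρ (fun i => y i + z) : ℝ≥0∞) =
      ∫⁻ y in Metric.ball x r, (ρ y : ℝ≥0∞) := by
    intro r hr0 hr
    have hball : Metric.ball x r = Set.univ.pi fun i => Metric.ball (x i) r := ball_pi x hr0
    have hdisj : Pairwise fun i j => Disjoint (Metric.ball (x i) r) (Metric.ball (x j) r) :=
      fun i j hij => Metric.ball_disjoint_ball (by linarith [hδ' i j hij])
    have h1 := factorialMoment_pi_translate hstat (fun i => Metric.ball (x i) r)
      (fun i => measurableSet_ball) hdisj z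
    have hm1 : MeasurableSet (Set.univ.pi fun i => Metric.ball (x i) r) :=
      MeasurableSet.univ_pi fun i => measurableSet_ball
    have hm2 : MeasurableSet (Set.univ.pi fun i => (fun y => y + z) '' Metric.ball (x i) r) :=
      MeasurableSet.univ_pi fun i =>
        (MeasurableEquiv.addRight z).measurableSet_image.2 measurableSet_ball
    rw [hρ.2 _ hm1, hρ.2 _ hm2, ← hmp.setLIntegral_comp_preimage_emb hemb] at h1
    rw [hball, ← h1]
    congr 2
    ext y
    simp
  have hcz : Continuous fun y : Fin n → E d => ρ (fun i => y i + z) :=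
    hc.comp (continuous_pi fun i => (continuous_apply i).add continuous_const)
  refine le_antisymm ?_ ?_
  · exact le_of_setLIntegral_ball_le (fun _ _ => measure_ball_lt_top) hcz hc x hδ
      fun r h0 h1 => (hint r h0 h1).le
  · exact le_of_setLIntegral_ball_le (fun _ _ => measure_ball_lt_top) hc hcz x hδ
      fun r h0 h1 => (hint r h0 h1).ge

/-- The continuous correlation functions of a stationary process are translation invariant. -/
theorem correlation_translate (hd : 1 ≤ d) {P : Measure Ω} {η : Ω → LocFinSet d}
    (hstat : IsStationaryProcess P η) {n : ℕ} {ρ : (Fin n → E d) → ℝ≥0}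
    (hρ : IsCorrelationFunction P η n ρ) (hc : Continuous ρ) (x : Fin n → E d) (z : E d) :
    ρ (fun i => x i + z) = ρ x := by
  have hcz : Continuous fun y : Fin n → E d => ρ (fun i => y i + z) :=
    hc.comp (continuous_pi fun i => (continuous_apply i).add continuous_const)
  -- Tuples of distinct points have full measure, and continuous functions equal almost everywhere
  -- coincide.
  have hae : (fun y : Fin n → E d => ρ (fun i => y i + z)) =ᵐ[volume] ρ := by
    filter_upwards [ae_injective hd n] with y hy
    exact correlation_translate_of_injective hstat hρ hc y hy z
  exact congrFun ((hcz.ae_eq_iff_eq volume hc).1 hae) x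

/-- The first correlation function fixes the diagonal of `K`; the second is then determined by `α ‖K
x y‖ ^ 2`, as `K` is Hermitian. Only the modulus can be recovered: replacing `K x y` by `u x * K x y
* conj (u y)` with `‖u‖ = 1` changes no correlation function. -/
theorem norm_kernel_translate {α : ℝ} (hα : α ≠ 0) {K : E d → E d → ℂ}
    (hK : (Matrix.of K).PosSemidef) {ρ : ∀ n, (Fin n → E d) → ℝ≥0}
    (hρ : ∀ n, 1 ≤ n → ∀ x, ((ρ n x : ℝ) : ℂ) = alphaDet α K n x)
    (hinv : ∀ n, 1 ≤ n → ∀ x z, ρ n (fun i => x i + z) = ρ n x) (x y z : E d) :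
    ‖K (x + z) (y + z)‖ = ‖K x y‖ := by
  have hherm : ∀ x y, K y x = starRingEnd ℂ (K x y) := fun x y => by
    have := hK.isHermitian.apply y x
    simpa using this.symm
  have h1 : ∀ x : E d, K (x + z) (x + z) = K x x := by
    intro x
    have h := fun x : E d => hρ 1 le_rfl (fun _ => x)
    have hx : ∀ x : E d, alphaDet α K 1 (fun _ => x) = K x x := by
      intro x
      unfold alphaDet
      rw [Fintype.sum_unique]
      have : (default : Equiv.Perm (Fin 1)).partition.parts.card = 1 := by
        rw [Equiv.Perm.parts_partition]; simp
      rw [this]; simp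
    rw [← hx, ← hx, ← h, ← h]
    have := hinv 1 le_rfl (fun _ => x) z
    rw [this]
  have h2 : K (x + z) (x + z) * K (y + z) (y + z) + α * (K (x + z) (y + z) * K (y + z) (x + z)) =
      K x x * K y y + α * (K x y * K y x) := by
    have hx : ∀ x y : E d, alphaDet α K 2 ![x, y] = K x x * K y y + α * (K x y * K y x) := by
      intro x y
      unfold alphaDet
      have hu : (Finset.univ : Finset (Equiv.Perm (Fin 2))) = {1, Equiv.swap 0 1} := by decide
      rw [hu, Finset.sum_pair (by decide)]
      have e1 : (1 : Equiv.Perm (Fin 2)).partition.parts.card = 2 := by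
        rw [Equiv.Perm.parts_partition]; simp
      have e2 : (Equiv.swap (0 : Fin 2) 1).partition.parts.card = 1 := by
        rw [Equiv.Perm.parts_partition, (Equiv.Perm.isSwap_iff_cycleType.1
          ⟨0, 1, by decide, rfl⟩), Equiv.Perm.card_support_swap (by decide)]
        simp
      rw [e1, e2]
      simp
    rw [← hx, ← hx, ← hρ 2 one_le_two, ← hρ 2 one_le_two]
    have := hinv 2 one_le_two ![x, y] z
    rw [← this]
    congr 3
    funext i
    fin_cases i <;> rfl
  rw [h1, h1] at h2
  have h3 := mul_left_cancel₀ (Complex.ofReal_ne_zero.2 hα) (add_left_cancel h2)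
  rw [hherm (x + z), hherm x y, Complex.mul_conj, Complex.mul_conj] at h3
  have h4 : Complex.normSq (K (x + z) (y + z)) = Complex.normSq (K x y) := by exact_mod_cast h3
  rw [Complex.normSq_eq_norm_sq, Complex.normSq_eq_norm_sq] at h4
  exact (sq_eq_sq₀ (norm_nonneg _) (norm_nonneg _)).1 h4

end Stationarity

/-! ### Disintegration of a translation invariant density -/

section Reduced

variable {d : ℕ}

theorem volume_preserving_finCons (n : ℕ) :
    MeasurePreserving (fun p : E d × (Fin n → E d) => (Fin.cons p.1 p.2 : Fin (n + 1) → E d)) := by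
  have h := (volume_preserving_piFinSuccAbove (fun _ : Fin (n + 1) => E d) 0).symm
  convert h using 1
  funext p
  exact (Fin.insertNth_zero' p.1 p.2).symm

theorem measurableEmbedding_finCons (n : ℕ) :
    MeasurableEmbedding (fun p : E d × (Fin n → E d) =>
      (Fin.cons p.1 p.2 : Fin (n + 1) → E d)) := by
  have h := (MeasurableEquiv.piFinSuccAbove (fun _ : Fin (n + 1) => E d) 0).symm.measurableEmbedding
  convert h using 1
  funext p
  exact (Fin.insertNth_zero' p.1 p.2).symm

theorem continuous_finCons_left (n : ℕ) (x : E d) :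
    Continuous fun y : Fin n → E d => (Fin.cons x y : Fin (n + 1) → E d) :=
  Continuous.finCons continuous_const continuous_id

/-- Apply Fubini, substitute `y + x` for `y`, and use `f (x, y + x) = f (0, y)`. -/
theorem isReducedMeasure_ofDensity {n : ℕ}
    (hvol : ∀ (n : ℕ) (B : Set (Fin n → E d)), Bornology.IsBounded B → volume B < ∞)
    {f : (Fin (n + 1) → E d) → ℝ} (hf : Measurable f) {C : ℝ} (hC : ∀ x, |f x| ≤ C)
    (hinv : ∀ x z, f (fun i => x i + z) = f x)
    (hg : Measurable fun y : Fin n → E d => f (Fin.cons 0 y)) :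
    IsReducedMeasure (LocFinSignedMeasure.ofDensity (hvol (n + 1)) f hf C hC)
      (LocFinSignedMeasure.ofDensity (hvol n) (fun y => f (Fin.cons 0 y)) hg C
        (fun _ => hC _)) := by
  intro S hS hSb
  rw [LocFinSignedMeasure.value_ofDensity _ _ _ hS hSb, ← integral_indicator hS,
    ← (volume_preserving_finCons n).integral_comp (measurableEmbedding_finCons n)]
  have hint : Integrable (S.indicator f) :=
    (LocFinSignedMeasure.integrableOn_density (hvol _) hf hC hSb).integrable_indicator hS
  have hint' : Integrable (fun p : E d × (Fin n → E d) =>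
      S.indicator f (Fin.cons p.1 p.2)) := ((volume_preserving_finCons n).integrable_comp_emb
    (measurableEmbedding_finCons n)).2 hint
  rw [Measure.volume_eq_prod] at hint' ⊢
  rw [integral_prod _ hint']
  refine integral_congr_ae (ae_of_all _ fun x => ?_)
  have hcont : Continuous fun y : Fin n → E d =>
      (Fin.cons x (fun i => y i + x) : Fin (n + 1) → E d) :=
    (continuous_finCons_left n x).comp
      (continuous_pi fun i => (continuous_apply i).add continuous_const)
  have hTm : MeasurableSet {y : Fin n → E d |
      (Fin.cons x (fun i => y i + x) : Fin (n + 1) → E d) ∈ S} := hcont.measurable hS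
  -- `value` is known to be the integral of the density only on bounded sets.
  have hTb : Bornology.IsBounded {y : Fin n → E d |
      (Fin.cons x (fun i => y i + x) : Fin (n + 1) → E d) ∈ S} := by
    obtain ⟨R, hR⟩ := hSb.exists_norm_le
    refine isBounded_iff_forall_norm_le.2 ⟨R + ‖x‖, fun y hy => ?_⟩
    have h1 := hR _ hy
    have h0 : 0 ≤ R := (norm_nonneg _).trans h1
    refine (pi_norm_le_iff_of_nonneg (add_nonneg h0 (norm_nonneg _))).2 fun i => ?_
    have h2 : ‖y i + x‖ ≤ R := by
      have := (norm_le_pi_norm (Fin.cons x (fun i => y i + x) : Fin (n + 1) → E d) i.succ).trans h1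
      simpa using this
    calc ‖y i‖ = ‖(y i + x) - x‖ := by simp
      _ ≤ ‖y i + x‖ + ‖x‖ := norm_sub_le _ _
      _ ≤ R + ‖x‖ := by gcongr
  beta_reduce
  rw [LocFinSignedMeasure.value_ofDensity _ _ _ hTm hTb, ← integral_indicator hTm]
  rw [← integral_add_right_eq_self (μ := volume)
    (fun y : Fin n → E d => S.indicator f (Fin.cons x y)) (fun _ => x)]
  refine integral_congr_ae (ae_of_all _ fun y => ?_)
  have hshift : f (Fin.cons x (fun i => y i + x)) = f (Fin.cons 0 y) := by
    rw [← hinv (Fin.cons 0 y) x]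
    congr 1
    funext i
    refine Fin.cases ?_ (fun j => ?_) i <;> simp
  change S.indicator f (Fin.cons x (fun i => y i + x)) = _
  by_cases hy : (Fin.cons x (fun i => y i + x) : Fin (n + 1) → E d) ∈ S
  · rw [Set.indicator_of_mem hy, hshift]
    exact (Set.indicator_of_mem (M := ℝ) (s := {y : Fin n → E d |
      (Fin.cons x (fun i => y i + x) : Fin (n + 1) → E d) ∈ S}) hy
      (fun y => f (Fin.cons 0 y))).symm
  · rw [Set.indicator_of_notMem hy]
    exact (Set.indicator_of_notMem (M := ℝ) (s := {y : Fin n → E d |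
      (Fin.cons x (fun i => y i + x) : Fin (n + 1) → E d) ∈ S}) hy
      (fun y => f (Fin.cons 0 y))).symm

end Reduced

/-! ### Integrals of kernel products along paths -/

section PathBound

/-- The increments of the path `a, y 0, …, y (n - 1)`. -/
def pathIncrement {X : Type*} [Sub X] {n : ℕ} (a : X) (y : Fin n → X) (j : Fin n) : X :=
  y j - (Fin.cons a y : Fin (n + 1) → X) j.castSucc

theorem pathIncrement_cons_zero {X : Type*} [Sub X] {n : ℕ} (a b : X) (y : Fin n → X) :
    pathIncrement a (Fin.cons b y : Fin (n + 1) → X) 0 = b - a := rfl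

theorem pathIncrement_cons_succ {X : Type*} [Sub X] {n : ℕ} (a b : X) (y : Fin n → X)
    (j : Fin n) : pathIncrement a (Fin.cons b y : Fin (n + 1) → X) j.succ = pathIncrement b y j := by
  simp [pathIncrement]

variable {d : ℕ}

theorem measurable_pathIncrement {n : ℕ} (j : Fin n) :
    Measurable fun p : E d × (Fin n → E d) => pathIncrement p.1 p.2 j := by
  unfold pathIncrement
  exact ((measurable_pi_apply j).comp measurable_snd).sub
    ((measurable_pi_apply _).comp (measurableEmbedding_finCons n).measurable)

/-- Peel off the first step: the remaining path integral does not depend on its starting point, so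
the induction runs over all `a`. -/
theorem lintegral_prod_pathIncrement {h : E d → ℝ≥0∞} (hh : Measurable h) (n : ℕ) (a : E d) :
    ∫⁻ y : Fin n → E d, ∏ j, h (pathIncrement a y j) = (∫⁻ z, h z) ^ n := by
  induction n generalizing a with
  | zero => simp [volume_pi]
  | succ n ih =>
    have hmeas : ∀ m, Measurable fun p : E d × (Fin m → E d) =>
        ∏ j, h (pathIncrement p.1 p.2 j) := fun m =>
      Finset.measurable_fun_prod _ fun j _ => hh.comp (measurable_pathIncrement j)
    have hstep : ∀ p : E d × (Fin n → E d),
        ∏ j, h (pathIncrement a (Fin.cons p.1 p.2 : Fin (n + 1) → E d) j) =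
          h (p.1 - a) * ∏ j, h (pathIncrement p.1 p.2 j) := by
      intro p
      rw [Fin.prod_univ_succ, pathIncrement_cons_zero]
      simp_rw [pathIncrement_cons_succ]
    rw [← (volume_preserving_finCons n).lintegral_comp_emb (measurableEmbedding_finCons n)]
    simp_rw [hstep]
    have h1 : Measurable fun p : E d × (Fin n → E d) => h (p.1 - a) :=
      hh.comp (measurable_fst.sub_const a)
    rw [Measure.volume_eq_prod, lintegral_prod (fun p : E d × (Fin n → E d) =>
      h (p.1 - a) * ∏ j, h (pathIncrement p.1 p.2 j)) (h1.mul (hmeas n)).aemeasurable]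
    have h2 : ∀ x : E d, ∫⁻ y : Fin n → E d, h (x - a) * ∏ j, h (pathIncrement x y j) =
        h (x - a) * (∫⁻ z, h z) ^ n := by
      intro x
      rw [lintegral_const_mul, ih]
      exact (hmeas n).comp measurable_prodMk_left
    simp_rw [h2]
    rw [lintegral_mul_const, lintegral_sub_right_eq_self h a, pow_succ, mul_comm]
    exact hh.comp (measurable_id.sub_const a)

/-- Iterate `1 + ‖u + v‖ ≤ (1 + ‖u‖) * (1 + ‖v‖)`; the factors after step `i` are at least `1`. -/
theorem one_add_norm_sub_le_prod {n : ℕ} (a : E d) (y : Fin n → E d) (i : Fin n) :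
    1 + ‖y i - a‖ ≤ ∏ j, (1 + ‖pathIncrement a y j‖) := by
  induction n generalizing a with
  | zero => exact i.elim0
  | succ n ih =>
    obtain ⟨b, w, rfl⟩ : ∃ b w, y = Fin.cons b w := ⟨y 0, Fin.tail y, (Fin.cons_self_tail y).symm⟩
    rw [Fin.prod_univ_succ, pathIncrement_cons_zero]
    simp_rw [pathIncrement_cons_succ]
    have hone : ∀ (j : Fin n), 1 ≤ 1 + ‖pathIncrement b w j‖ := fun j => by
      have := norm_nonneg (pathIncrement b w j); linarith
    refine Fin.cases ?_ (fun k => ?_) i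
    · simp only [Fin.cons_zero]
      refine le_mul_of_one_le_right (by positivity) ?_
      calc (1 : ℝ) = ∏ _j : Fin n, 1 := by simp
        _ ≤ _ := Finset.prod_le_prod (fun _ _ => zero_le_one) fun j _ => hone j
    · simp only [Fin.cons_succ]
      calc 1 + ‖w k - a‖ ≤ (1 + ‖b - a‖) * (1 + ‖w k - b‖) := by
            have h1 : ‖w k - a‖ ≤ ‖w k - b‖ + ‖b - a‖ := norm_sub_le_norm_sub_add_norm_sub _ _ _
            have h2 := mul_nonneg (norm_nonneg (b - a)) (norm_nonneg (w k - b))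
            nlinarith
        _ ≤ _ := by
            gcongr
            exact ih b w k

/-- The points `0, σ 0, σ² 0, …` exhaust the index set when there is a single orbit; `τ` records
this order with `0` removed. -/
theorem exists_cyclic_enumeration {n : ℕ} (σ : Equiv.Perm (Fin (n + 1)))
    (hσ : σ.partition.parts.card = 1) :
    ∃ τ : Equiv.Perm (Fin n),
      Function.Bijective (Fin.cons 0 (fun j => (τ j).succ) : Fin (n + 1) → Fin (n + 1)) ∧
      ∀ j : Fin n, σ ((Fin.cons 0 (fun j => (τ j).succ) : Fin (n + 1) → Fin (n + 1)) j.castSucc) =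
        (τ j).succ := by
  classical
  have hsame : ∀ v, σ.SameCycle 0 v := by
    intro v
    rw [card_parts_partition_eq_card_quotient, Fintype.card_eq_one_iff] at hσ
    obtain ⟨q, hq⟩ := hσ
    exact Quotient.exact (s := Equiv.Perm.SameCycle.setoid σ)
      ((hq (Quotient.mk _ 0)).trans (hq (Quotient.mk _ v)).symm)
  let q : Fin (n + 1) → Fin (n + 1) := fun j => (σ ^ (j : ℕ)) 0
  have hper : 0 < Function.minimalPeriod σ 0 := by
    refine Function.minimalPeriod_pos_of_mem_periodicPts ?_
    exact ⟨orderOf σ, orderOf_pos σ, by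
      rw [Function.IsPeriodicPt, Function.IsFixedPt, ← Equiv.Perm.coe_pow, pow_orderOf_eq_one]
      rfl⟩
  have hperle : Function.minimalPeriod σ 0 ≤ n + 1 := by
    simpa using Function.minimalPeriod_le_card (f := σ) (x := (0 : Fin (n + 1)))
  have hsurj : Function.Surjective q := by
    intro v
    obtain ⟨i, -, hi⟩ := (hsame v).exists_pow_eq'
    -- Reducing the exponent modulo the period of `0` brings it below `n + 1`.
    refine ⟨⟨i % Function.minimalPeriod σ 0, (Nat.mod_lt _ hper).trans_le hperle⟩, ?_⟩
    simp only [q]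
    rw [Equiv.Perm.coe_pow, Function.iterate_mod_minimalPeriod_eq, ← Equiv.Perm.coe_pow, hi]
  have hbij : Function.Bijective q := Finite.surjective_iff_bijective.1 hsurj
  have hq0 : q 0 = 0 := by simp [q]
  have hne : ∀ j : Fin n, q j.succ ≠ 0 := fun j h => by
    rw [← hq0] at h
    exact Fin.succ_ne_zero j (hbij.1 h)
  let τ : Equiv.Perm (Fin n) := Equiv.ofBijective (fun j => (q j.succ).pred (hne j)) <|
    Finite.injective_iff_bijective.1 fun i j hij =>
      Fin.succ_injective _ (hbij.1 (Fin.pred_inj.1 hij))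
  have hτ : ∀ j, (τ j).succ = q j.succ := fun j => Fin.succ_pred _ (hne j)
  have hcons : (Fin.cons 0 (fun j => (τ j).succ) : Fin (n + 1) → Fin (n + 1)) = q := by
    funext i
    refine Fin.cases ?_ (fun j => ?_) i
    · simp [hq0]
    · simp [hτ]
  refine ⟨τ, ?_, fun j => ?_⟩
  · rw [hcons]; exact hbij
  · rw [hcons, hτ]
    simp [q, pow_succ']

theorem prod_norm_le_prod_pathIncrement {K : E d → E d → ℂ} {c : ℝ} (hc : ∀ x y, ‖K x y‖ ≤ c)
    (hK : ∀ x y z, ‖K (x + z) (y + z)‖ = ‖K x y‖) {n : ℕ} (σ : Equiv.Perm (Fin (n + 1)))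
    (hσ : σ.partition.parts.card = 1) :
    ∃ τ : Equiv.Perm (Fin n), ∀ y : Fin n → E d,
      ∏ v, ‖K ((Fin.cons 0 y : Fin (n + 1) → E d) v) ((Fin.cons 0 y : Fin (n + 1) → E d) (σ v))‖ ≤
        c * ∏ j, ‖K 0 (pathIncrement 0 (fun i => y (τ i)) j)‖ := by
  obtain ⟨τ, hbij, hτ⟩ := exists_cyclic_enumeration σ hσ
  refine ⟨τ, fun y => ?_⟩
  set q : Fin (n + 1) → Fin (n + 1) := Fin.cons 0 (fun j => (τ j).succ) with hq
  have hval : ∀ j, (Fin.cons 0 y : Fin (n + 1) → E d) (q j) =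
      (Fin.cons 0 (fun i => y (τ i)) : Fin (n + 1) → E d) j := by
    intro j
    refine Fin.cases ?_ (fun i => ?_) j <;> simp [hq]
  -- In cyclic order the last factor closes the cycle back to `0`; it alone is bounded by `c`.
  rw [← hbij.prod_comp, Fin.prod_univ_castSucc, mul_comm]
  refine mul_le_mul (hc _ _) (le_of_eq ?_) (Finset.prod_nonneg fun _ _ => norm_nonneg _)
    ((norm_nonneg _).trans (hc 0 0))
  refine Finset.prod_congr rfl fun j _ => ?_
  rw [hτ, hval, Fin.cons_succ]
  unfold pathIncrement
  set b := (Fin.cons 0 (fun i => y (τ i)) : Fin (n + 1) → E d) j.castSucc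
  have := hK 0 (y (τ j) - b) b
  rw [zero_add, sub_add_cancel] at this
  exact this

/-- The weighted product of the kernel along a cyclic permutation is integrable. -/
theorem lintegral_cyclic_lt_top {K : E d → E d → ℂ}
    (hKcont : Continuous fun p : E d × E d => K p.1 p.2) {c : ℝ} (hc : ∀ x y, ‖K x y‖ ≤ c)
    (hK : ∀ x y z, ‖K (x + z) (y + z)‖ = ‖K x y‖)
    (hint : Integrable fun x : E d => ‖x‖ * ‖K 0 x‖) {n : ℕ} (σ : Equiv.Perm (Fin (n + 2)))
    (hσ : σ.partition.parts.card = 1) :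
    ∫⁻ y : Fin (n + 1) → E d, ENNReal.ofReal
      ((∏ v, ‖K ((Fin.cons 0 y : Fin (n + 2) → E d) v)
        ((Fin.cons 0 y : Fin (n + 2) → E d) (σ v))‖) * (1 + ‖y 0‖)) < ∞ := by
  have hc0 : 0 ≤ c := (norm_nonneg _).trans (hc 0 0)
  obtain ⟨τ, hτ⟩ := prod_norm_le_prod_pathIncrement hc hK σ hσ
  have hK0 : Continuous fun z : E d => ‖K 0 z‖ := by
    have h : Continuous fun z : E d => ((0 : E d), z) := by fun_prop
    exact (hKcont.comp h).norm
  let h : E d → ℝ≥0∞ := fun z => ENNReal.ofReal ((1 + ‖z‖) * ‖K 0 z‖)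
  have hh : Measurable h := by
    refine (Continuous.measurable ?_).ennreal_ofReal
    exact (continuous_const.add continuous_norm).mul hK0
  have hfin : ∫⁻ z, h z < ∞ := by
    -- The weight is at most `c + 2 ‖z‖ ‖K 0 z‖` in the unit ball and `2 ‖z‖ ‖K 0 z‖` outside.
    have hI : Integrable fun z : E d => (1 + ‖z‖) * ‖K 0 z‖ := by
      have hball : Integrable ((Metric.ball (0 : E d) 1).indicator fun _ => c) := by
        rw [integrable_indicator_iff measurableSet_ball]
        exact integrableOn_const measure_ball_lt_top.ne
      refine (hball.add (hint.const_mul 2)).mono'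
        ((continuous_const.add continuous_norm).mul hK0).aestronglyMeasurable
        (ae_of_all _ fun z => ?_)
      have hk := norm_nonneg (K 0 z)
      rw [Real.norm_of_nonneg (by positivity)]
      simp only [Pi.add_apply]
      by_cases hz : z ∈ Metric.ball (0 : E d) 1
      · rw [Set.indicator_of_mem hz]
        have := hc 0 z
        nlinarith [norm_nonneg z]
      · rw [Set.indicator_of_notMem hz]
        have : 1 ≤ ‖z‖ := by simpa using hz
        nlinarith
    exact hI.lintegral_lt_top
  have hbound : ∀ y : Fin (n + 1) → E d, ENNReal.ofReal
      ((∏ v, ‖K ((Fin.cons 0 y : Fin (n + 2) → E d) v)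
        ((Fin.cons 0 y : Fin (n + 2) → E d) (σ v))‖) * (1 + ‖y 0‖)) ≤
      ENNReal.ofReal c * ∏ j, h (pathIncrement 0 (fun i => y (τ i)) j) := by
    intro y
    rw [← ENNReal.ofReal_prod_of_nonneg (fun j _ => by positivity), ← ENNReal.ofReal_mul hc0]
    refine ENNReal.ofReal_le_ofReal ?_
    rw [Finset.prod_mul_distrib]
    -- `τ.symm 0` is the step at which the reordered path visits `y 0`.
    have h1 := one_add_norm_sub_le_prod 0 (fun i => y (τ i)) (τ.symm 0)
    simp only [Equiv.apply_symm_apply, sub_zero] at h1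
    calc _ ≤ (c * ∏ j, ‖K 0 (pathIncrement 0 (fun i => y (τ i)) j)‖) *
          ∏ j, (1 + ‖pathIncrement 0 (fun i => y (τ i)) j‖) := by
            refine mul_le_mul (hτ y) h1 (by positivity) ?_
            exact mul_nonneg hc0 (Finset.prod_nonneg fun _ _ => norm_nonneg _)
      _ = _ := by ring
  refine (lintegral_mono hbound).trans_lt ?_
  rw [lintegral_const_mul' _ _ ENNReal.ofReal_ne_top]
  refine ENNReal.mul_lt_top ENNReal.ofReal_lt_top ?_
  -- Permuting the coordinates by `τ` preserves volume, so the order of visits is irrelevant.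
  have hmp := volume_measurePreserving_piCongrLeft (fun _ : Fin (n + 1) => E d) τ.symm
  have happ : ∀ y : Fin (n + 1) → E d,
      MeasurableEquiv.piCongrLeft (fun _ : Fin (n + 1) => E d) τ.symm y = fun i => y (τ i) := by
    intro y
    funext i
    have := Equiv.piCongrLeft_apply_apply (fun _ : Fin (n + 1) => E d) τ.symm y (τ i)
    rw [Equiv.symm_apply_apply] at this
    exact this
  have hcomp := hmp.lintegral_comp_emb (MeasurableEquiv.measurableEmbedding _)
    (fun y => ∏ j, h (pathIncrement 0 y j))
  simp_rw [happ] at hcomp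
  rw [hcomp, lintegral_prod_pathIncrement hh]
  exact ENNReal.pow_lt_top hfin

end PathBound

/-! ### Finite moments and integrability of the reduced density -/

section Moments

variable {d : ℕ} {Ω : Type*} [MeasurableSpace Ω]

theorem encard_distinctTuples_pi_const (m : ℕ) (μ : LocFinSet d) (B : Set (E d))
    (hB : (μ.carrier ∩ B).Finite) :
    (distinctTuples (Fin m) μ ∩ Set.univ.pi fun _ => B).encard =
      ((μ.carrier ∩ B).ncard.descFactorial m : ℕ) := by
  have : Fintype ↑(μ.carrier ∩ B) := hB.fintype
  have himg : distinctTuples (Fin m) μ ∩ Set.univ.pi (fun _ => B) =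
      (fun (g : Fin m ↪ ↑(μ.carrier ∩ B)) i => (g i).1) '' Set.univ := by
    ext x
    simp only [distinctTuples, Set.mem_inter_iff, Set.mem_ofPred_eq, Set.mem_pi, Set.mem_univ,
      true_imp_iff, Set.image_univ, Set.mem_range]
    constructor
    · rintro ⟨⟨h1, h2⟩, h3⟩
      exact ⟨⟨fun i => ⟨x i, h2 i, h3 i⟩, fun i j hij => h1 (congrArg Subtype.val hij)⟩, rfl⟩
    · rintro ⟨g, rfl⟩
      exact ⟨⟨fun i j hij => g.injective (Subtype.ext hij), fun i => (g i).2.1⟩,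
        fun i => (g i).2.2⟩
  have hinj : Function.Injective
      (fun (g : Fin m ↪ ↑(μ.carrier ∩ B)) i => (g i).1) := by
    intro g h hgh
    ext i
    exact congrArg (fun x : Fin m → E d => x i _) hgh
  rw [himg, hinj.encard_image, Set.encard_univ, ENat.card_eq_coe_fintype_card,
    Fintype.card_embedding_eq, Fintype.card_fin, ← Nat.card_coe_set_eq, Nat.card_eq_fintype_card]

/-- For `N ≥ m ≥ 1` one has `N ≤ m * (N + 1 - m)`, and each factor of the descending factorial is at
least `N + 1 - m`. -/
theorem pow_le_pow_add_mul_descFactorial (N m : ℕ) :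
    N ^ m ≤ m ^ m + m ^ m * N.descFactorial m := by
  rcases lt_or_ge N m with h | h
  · exact (Nat.pow_le_pow_left h.le m).trans (Nat.le_add_right _ _)
  · rcases Nat.eq_zero_or_pos m with rfl | hm
    · simp
    · have h1 : N ≤ m * (N + 1 - m) := by
        obtain ⟨k, rfl⟩ := Nat.exists_eq_add_of_le h
        have : m + k + 1 - m = k + 1 := by omega
        rw [this]
        nlinarith
      calc N ^ m ≤ (m * (N + 1 - m)) ^ m := Nat.pow_le_pow_left h1 m
        _ = m ^ m * (N + 1 - m) ^ m := mul_pow _ _ _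
        _ ≤ m ^ m * N.descFactorial m := Nat.mul_le_mul_left _ (Nat.pow_sub_le_descFactorial N m)
        _ ≤ _ := Nat.le_add_left _ _

theorem hasFiniteMoments_of_correlation {P : Measure Ω} [IsProbabilityMeasure P]
    {η : Ω → LocFinSet d} {ρ : ∀ n, (Fin n → E d) → ℝ≥0}
    (hρ : ∀ n, 1 ≤ n → IsCorrelationFunction P η n (ρ n))
    (hb : ∀ n, 1 ≤ n → ∃ C : ℝ, ∀ x, (ρ n x : ℝ) ≤ C) : HasFiniteMoments P η := by
  intro m B hB hBb
  rcases Nat.eq_zero_or_pos m with rfl | hm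
  · simp
  have hle : ∀ ω, (((η ω).count B : ℕ∞) : ℝ≥0∞) ^ m ≤ (m : ℝ≥0∞) ^ m + (m : ℝ≥0∞) ^ m *
      ((distinctTuples (Fin m) (η ω) ∩ Set.univ.pi fun _ => B).encard : ℝ≥0∞) := by
    intro ω
    have hfin := (η ω).finite_inter B hBb
    rw [encard_distinctTuples_pi_const m _ _ hfin, LocFinSet.count, ← hfin.cast_ncard_eq]
    have := pow_le_pow_add_mul_descFactorial ((η ω).carrier ∩ B).ncard m
    simp only [ENat.toENNReal_coe]
    exact_mod_cast this
  have htop : (m : ℝ≥0∞) ^ m < ∞ := ENNReal.pow_lt_top (ENNReal.natCast_lt_top m)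
  refine (lintegral_mono hle).trans_lt ?_
  rw [lintegral_add_left measurable_const, lintegral_const, measure_univ, mul_one,
    lintegral_const_mul' _ _ htop.ne]
  refine ENNReal.add_lt_top.2 ⟨htop, ENNReal.mul_lt_top htop ?_⟩
  obtain ⟨C, hC⟩ := hb m hm
  have hmoment := (hρ m hm).2 (Set.univ.pi fun _ => B) (MeasurableSet.univ_pi fun _ => hB)
  unfold factorialMoment at hmoment
  rw [hmoment]
  refine (lintegral_mono (g := fun _ => ENNReal.ofReal C) fun x => ?_).trans_lt ?_
  · rw [← ENNReal.ofReal_coe_nnreal]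
    exact ENNReal.ofReal_le_ofReal (hC x)
  · rw [setLIntegral_const]
    exact ENNReal.mul_lt_top ENNReal.ofReal_lt_top
      (volume_pi_lt_top_of_isBounded _ (Bornology.IsBounded.pi fun _ => hBb))

theorem lintegral_cumulantDensity_lt_top {α : ℝ} {K : E d → E d → ℂ}
    (hKcont : Continuous fun p : E d × E d => K p.1 p.2) (hKpos : (Matrix.of K).PosSemidef)
    (hKbdd : ∃ c : ℝ, ∀ x y, ‖K x y‖ ≤ c) (hint : Integrable fun x : E d => ‖x‖ * ‖K 0 x‖)
    {ρ : ∀ n, (Fin n → E d) → ℝ≥0}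
    (hρ : ∀ n, 1 ≤ n → ∀ x, ((ρ n x : ℝ) : ℂ) = alphaDet α K n x)
    (hinv : ∀ n, 1 ≤ n → ∀ x z, ρ n (fun i => x i + z) = ρ n x) (k : ℕ) :
    ∫⁻ y : Fin (k + 1) → E d,
      ENNReal.ofReal |cumulantDensity ρ (k + 2) (Fin.cons 0 y)| * ENNReal.ofReal (1 + ‖y 0‖)
        < ∞ := by
  obtain ⟨c, hc⟩ := hKbdd
  have hκ := fun y : Fin (k + 1) → E d =>
    cumulantDensity_eq_sum_cyclic hρ (show 1 ≤ k + 2 by omega) (Fin.cons 0 y)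
  -- For `α = 0` nothing is known about translates of `K`, but the factor `α ^ (k + 1)` annihilates
  -- the density.
  rcases eq_or_ne α 0 with rfl | hα
  · have hzero : ∀ y : Fin (k + 1) → E d, cumulantDensity ρ (k + 2) (Fin.cons 0 y) = 0 := by
      intro y
      have h := hκ y
      simp only [Complex.ofReal_zero, show k + 2 - 1 = k + 1 by omega, ne_eq, Nat.succ_ne_zero,
        not_false_eq_true, zero_pow, zero_mul, Finset.sum_const_zero] at h
      exact_mod_cast h
    simp [hzero]
  have hbound : ∀ y : Fin (k + 1) → E d,
      ENNReal.ofReal |cumulantDensity ρ (k + 2) (Fin.cons 0 y)| * ENNReal.ofReal (1 + ‖y 0‖) ≤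
      ∑ σ : Equiv.Perm (Fin (k + 2)) with σ.partition.parts.card = 1,
        ENNReal.ofReal (|α| ^ (k + 1)) * ENNReal.ofReal
          ((∏ v, ‖K ((Fin.cons 0 y : Fin (k + 2) → E d) v)
            ((Fin.cons 0 y : Fin (k + 2) → E d) (σ v))‖) * (1 + ‖y 0‖)) := by
    intro y
    simp_rw [← ENNReal.ofReal_mul (pow_nonneg (abs_nonneg α) (k + 1))]
    rw [← ENNReal.ofReal_mul (abs_nonneg _), ← ENNReal.ofReal_sum_of_nonneg
      (fun σ _ => by positivity)]
    refine ENNReal.ofReal_le_ofReal ?_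
    simp_rw [← mul_assoc]
    rw [← Finset.sum_mul]
    refine mul_le_mul_of_nonneg_right ?_ (by positivity)
    rw [← Real.norm_eq_abs, ← Complex.norm_real, hκ]
    refine (norm_sum_le _ _).trans (le_of_eq (Finset.sum_congr rfl fun σ _ => ?_))
    rw [norm_mul, norm_prod, norm_pow, Complex.norm_real, Real.norm_eq_abs]
    rfl
  refine (lintegral_mono hbound).trans_lt ?_
  have hcont : ∀ i, Continuous fun y : Fin (k + 1) → E d => (Fin.cons 0 y : Fin (k + 2) → E d) i :=
    fun i => (continuous_apply i).comp (continuous_finCons_left (k + 1) 0)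
  have hKc : ∀ v w, Continuous fun y : Fin (k + 1) → E d =>
      ‖K ((Fin.cons 0 y : Fin (k + 2) → E d) v) ((Fin.cons 0 y : Fin (k + 2) → E d) w)‖ :=
    fun v w => (hKcont.comp ((hcont v).prodMk (hcont w))).norm
  rw [lintegral_finsetSum]
  · refine ENNReal.sum_lt_top.2 fun σ hσ => ?_
    rw [lintegral_const_mul' _ _ ENNReal.ofReal_ne_top]
    exact ENNReal.mul_lt_top ENNReal.ofReal_lt_top (lintegral_cyclic_lt_top hKcont hc
      (fun x y z => norm_kernel_translate hα hKpos hρ hinv x y z) hint σ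
      (Finset.mem_filter.1 hσ).2)
  · intro σ _
    refine Measurable.const_mul (Continuous.measurable ?_).ennreal_ofReal _
    exact (continuous_finsetProd _ fun v _ => hKc v (σ v)).mul
      (continuous_const.add (continuous_apply 0).norm)

end Moments

/-! ### The theorem -/

theorem mainTheorem5 {d : ℕ} (hd : 1 ≤ d) {Ω : Type*} [MeasurableSpace Ω] (P : Measure Ω)
    [IsProbabilityMeasure P] (η : Ω → LocFinSet d) (hη : IsPointProcess η)
    (hstat : IsStationaryProcess P η) (α : ℝ) (hα : -1 ≤ α) (K : E d → E d → ℂ)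
    (hKcont : Continuous fun p : E d × E d => K p.1 p.2)
    (hKpos : (Matrix.of K).PosSemidef)
    (hKbdd : ∃ c : ℝ, ∀ x y, ‖K x y‖ ≤ c)
    (hdet : IsAlphaDeterminantal P η α K)
    (hint : Integrable fun x : E d => ‖x‖ * ‖K 0 x‖) :
    HasFiniteMoments P η ∧ CumulantCondition P η := by
  -- `ρ 0` is arbitrary, which is harmless since blocks of partitions are nonempty.
  choose! ρ hρ hρK using hdet
  have hc : ∀ n, 1 ≤ n → Continuous (ρ n) := by
    intro n hn
    have h : Continuous fun x => (alphaDet α K n x).re :=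
      Complex.continuous_re.comp (continuous_alphaDet α hKcont n)
    have h' : Continuous fun x => (ρ n x : ℝ) := by
      refine h.congr fun x => ?_
      rw [← hρK n hn x, Complex.ofReal_re]
    exact NNReal.isEmbedding_coe.continuous_iff.2 h'
  have hb : ∀ n, 1 ≤ n → ∃ C : ℝ, ∀ x, (ρ n x : ℝ) ≤ C := by
    intro n hn
    obtain ⟨C, hC⟩ := exists_norm_alphaDet_le α hKbdd n
    refine ⟨C, fun x => ?_⟩
    have := hC x
    rw [← hρK n hn x, Complex.norm_real] at this
    exact (le_abs_self _).trans this
  have hinv : ∀ n, 1 ≤ n → ∀ x z, ρ n (fun i => x i + z) = ρ n x := fun n hn x z =>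
    correlation_translate hd hstat (hρ n hn) (hc n hn) x z
  refine ⟨hasFiniteMoments_of_correlation hρ hb, fun k => ?_⟩
  obtain ⟨C, hC⟩ := exists_abs_cumulantDensity_le hρK hKbdd (show 1 ≤ k + 2 by omega)
  have hκ := continuous_cumulantDensity hc (k + 2)
  have hκ0 : Continuous fun y : Fin (k + 1) → E d => cumulantDensity ρ (k + 2) (Fin.cons 0 y) :=
    hκ.comp (continuous_finCons_left (k + 1) 0)
  have hvol : ∀ (n : ℕ) (B : Set (Fin n → E d)), Bornology.IsBounded B → volume B < ∞ :=
    fun n => volume_pi_lt_top_of_isBounded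
  -- The reduced measure is given by the cumulant density with the first point at the origin.
  refine ⟨.ofDensity (hvol (k + 2)) (cumulantDensity ρ (k + 2)) hκ.measurable C hC,
    .ofDensity (hvol (k + 1)) (fun y => cumulantDensity ρ (k + 2) (Fin.cons 0 y)) hκ0.measurable C
      (fun y => hC _), ?_, ?_, ?_⟩
  · intro B hB hBb
    rw [LocFinSignedMeasure.value_ofDensity _ _ _ (MeasurableSet.univ_pi hB)
      (Bornology.IsBounded.pi hBb), factorialCumulant_eq_setIntegral hρ hc hb _ B hB hBb]
  · exact isReducedMeasure_ofDensity hvol hκ.measurable hC (cumulantDensity_add hinv (k + 2))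
      hκ0.measurable
  · rw [LocFinSignedMeasure.lintegral_totalVariation_ofDensity _ _ _
      (Continuous.measurable (by fun_prop)).ennreal_ofReal]
    exact lintegral_cumulantDensity_lt_top hKcont hKpos hKbdd hint hρK hinv k
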